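/- **Setting.** Consider an episodic MDP with horizon $H\ge 1$, run for $K\ge 1$ episodes, with a (possibly infinite) state space $\mathcal S$, a finite nonempty action space $\mathcal A$, discrete transition kernels $\mathbb P_h(\cdot\mid s,a)$ and known rewards $r_h:\mathcal S\times\mathcal A\to[0,1]$, $h\in[H]$. Let $\alpha\in(0,1]$ and, for a random variable $X$, $\mathrm{CVaR}^\alpha(X)=\sup_{x\in\mathbb R}\{x-\frac1\alpha\mathbb E[(x-X)^+]\}$. For a policy $\pi=(\pi_h:\mathcal S\to\mathcal A)_{h\in[H]}$ put $V^\pi_{H+1}=0$ and $V^\pi_h(s)=r_h(s,\pi_h(s))+\mathrm{CVaR}^\alpha_{s'\sim\mathbb P_h(\cdot\mid s,\pi_h(s))}(V^\pi_{h+1}(s'))$, and let $V^*_h(s)=\sup_\pi V^\pi_h(s)$. In episode $k$ the environment chooses an initial state $s_{k,1}$ (possibly at random and depending on the past episodes), the agent plays a policy $\pi^k$ that depends on the past episodes, and $s_{k,h+1}\sim\mathbb P_h(\cdot\mid s_{k,h},a_{k,h})$ with $a_{k,h}=\pi^k_h(s_{k,h})$. The regret is $\mathrm{Regret}(K)=\sum_{k=1}^K\big(V_1^*(s_{k,1})-V_1^{\pi^k}(s_{k,1})\big)$.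 **Linear mixture assumption.** A feature map $\phi:\mathcal S\times\mathcal S\times\mathcal A\to\mathbb R^d$ is known, and for every $h$ there is $\theta_h\in\mathbb R^d$ with $\|\theta_h\|_2\le\sqrt d$ and $\mathbb P_h(s'\mid s,a)=\langle\theta_h,\phi(s',s,a)\rangle$ for all $s',s,a$. Moreover, for every $f:\mathcal S\to[0,1]$ and all $(s,a)$, $\psi_f(s,a)=\sum_{s'}\phi(s',s,a)f(s')$ is well defined and $\|\psi_f(s,a)\|_2\le1$. **Algorithm ICVaR-L** (parameters $\varepsilon>0$, $\lambda>0$, $\widehat\beta$). Let $\mathcal N_\varepsilon=\{n\varepsilon:n=0,1,\dots,\lfloor H/\varepsilon\rfloor\}$ and $\|v\|_\Lambda=\sqrt{v^\top\Lambda v}$. Start with $\widehat\Lambda_{1,h}=\lambda I$, $\widehat\theta_{1,h}=0$. In episode $k$, put $\widehat V_{k,H+1}=0$ and for $h=H,\dots,1$ $$\widehat Q_{k,h}(s,a)=r_h(s,a)+\sup_{x\in\mathcal N_\varepsilon}\Big\{x-\tfrac1\alpha\big\langle\widehat\theta_{k,h},\psi_{(x-\widehat V_{k,h+1})^+}(s,a)\big\rangle\Big\}+2\varepsilon+\tfrac{\widehat\beta}{\alpha}\sup_{x\in\mathcal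 N_\varepsilon}\big\|\psi_{(x-\widehat V_{k,h+1})^+}(s,a)\big\|_{\widehat\Lambda_{k,h}^{-1}},$$ $\widehat V_{k,h}(s)=\min\{\max_a\widehat Q_{k,h}(s,a),H\}$ and $\pi^k_h(s)\in\arg\max_a\widehat Q_{k,h}(s,a)$. Play $\pi^k$. With $x_{k,h}\in\arg\max_{x\in\mathcal N_\varepsilon}\|\psi_{(x-\widehat V_{k,h+1})^+}(s_{k,h},a_{k,h})\|_{\widehat\Lambda_{k,h}^{-1}}$ and $\psi_{k,h}=\psi_{(x_{k,h}-\widehat V_{k,h+1})^+}(s_{k,h},a_{k,h})$, update $$\widehat\Lambda_{k+1,h}=\widehat\Lambda_{k,h}+\psi_{k,h}\psi_{k,h}^\top,\qquad \widehat\theta_{k+1,h}=\widehat\Lambda_{k+1,h}^{-1}\sum_{i=1}^k\psi_{i,h}\,(x_{i,h}-\widehat V_{i,h+1})^+(s_{i,h+1}).$$ Ties in the two $\arg\max$ are broken arbitrarily. **Theorem.** Let the linear mixture assumption hold, let $\delta\in(0,1]$, and set $\lambda=H^2$, $\varepsilon=dH\sqrt{\alpha^{H-3}/K}$ and $\widehat\beta=H\sqrt{d\log\frac{H+KH^3}{\delta}}+\sqrt\lambda$.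 Then, with probability at least $1-2\delta$, the regret of ICVaR-L satisfies $$\mathrm{Regret}(K)\le\frac{4dH^2\sqrt K}{\sqrt{\alpha^{H+1}}}+2\widehat\beta\sqrt{\frac{KH}{\alpha^{H+1}}}\sqrt{8dH\log K+4H^3\log\frac{4\log_2K+8}{\delta}}.$$ The right-hand side is $\widetilde O\big(\sqrt{\alpha^{-(H+1)}(d^2H^4+dH^6)K}\big)$: there is a universal constant $C>0$ such that, for all $d,H,K\ge1$ and $\alpha,\delta\in(0,1]$, it is at most $C\,(1+\log\frac{KH}{\delta})\sqrt{\alpha^{-(H+1)}(d^2H^4+dH^6)K}$. -/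

import Mathlib

open scoped Matrix

noncomputable section

namespace ICVaR

/-- `(x - V)⁺` as a function of the state. -/
def shortfall {S : Type*} (x : ℝ) (V : S → ℝ) : S → ℝ := fun s => max (x - V s) 0

/-- `CVaR^α` of the random variable `X` under the discrete distribution `p`:
the supremum over real `x` of `x - α⁻¹ E[(x - X)⁺]`. -/
def cvar {S : Type*} (α : ℝ) (p : PMF S) (X : S → ℝ) : ℝ :=
  ⨆ x : ℝ, (x - 1 / α * ∑' s, (p s).toReal * shortfall x X s)

/-- An episodic MDP with horizon `H`. Step number `h` of the episode is the element `h - 1` of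
`Fin H`; the states of an episode are indexed by `Fin (H + 1)` (step `H + 1` is the last one).
All distributions are discrete; the state space may be infinite. -/
structure EpisodicMDP (S A : Type*) (H : ℕ) where
  /-- transition kernels -/
  P : Fin H → S → A → PMF S
  /-- deterministic rewards -/
  r : Fin H → S → A → ℝ
  r_mem : ∀ h s a, r h s a ∈ Set.Icc (0 : ℝ) 1

/-- Deterministic Markov policies. -/
abbrev Policy (S A : Type*) (H : ℕ) := Fin H → S → A

/-- The states visited in one episode. -/
abbrev Episode (S : Type*) (H : ℕ) := Fin (H + 1) → S

/-- Past episodes, the most recent one first. -/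
abbrev History (S : Type*) (H : ℕ) := List (Episode S H)

/-- The iterated CVaR value function `V_h^π`, by the CVaR Bellman equation, backwards from
`V_{H+1}^π = 0`. -/
def policyValue {S A : Type*} {H : ℕ} (α : ℝ) (M : EpisodicMDP S A H) (π : Policy S A H) :
    Fin (H + 1) → S → ℝ :=
  Fin.reverseInduction (motive := fun _ => S → ℝ) (fun _ => 0)
    (fun h Vnext s => M.r h s (π h s) + cvar α (M.P h s (π h s)) Vnext)

/-- The optimal value function `V_h^*(s)`, the best `V_h^π(s)` over all policies. -/
def optimalValue {S A : Type*} {H : ℕ} (α : ℝ) (M : EpisodicMDP S A H)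
    (h : Fin (H + 1)) (s : S) : ℝ :=
  ⨆ π : Policy S A H, policyValue α M π h s

/-- `ψ_f(s, a) = ∑_{s'} f(s') φ(s', s, a)`. -/
def psi {S A : Type*} {d : ℕ} (φ : S → S → A → Fin d → ℝ) (f : S → ℝ) (s : S) (a : A) :
    Fin d → ℝ :=
  ∑' s', f s' • φ s' s a

/-- The normalization of the feature map: `ψ_f` is well defined and has Euclidean norm at most `1`
for every `f : S → [0, 1]`. -/
def IsNormalizedFeature {S A : Type*} {d : ℕ} (φ : S → S → A → Fin d → ℝ) : Prop :=
  ∀ s a, Summable (fun s' => φ s' s a) ∧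
    ∀ f : S → ℝ, (∀ s', f s' ∈ Set.Icc (0 : ℝ) 1) → ‖WithLp.toLp 2 (psi φ f s a)‖ ≤ 1

/-- The linear mixture assumption. -/
def IsLinearMixture {S A : Type*} {H d : ℕ} (M : EpisodicMDP S A H)
    (φ : S → S → A → Fin d → ℝ) : Prop :=
  ∀ h, ∃ θ : Fin d → ℝ, ‖WithLp.toLp 2 θ‖ ≤ √(d : ℝ) ∧
    ∀ s' s a, (M.P h s a s').toReal = θ ⬝ᵥ φ s' s a

/-- `‖v‖_Λ = √(vᵀ Λ v)`. -/
def weightedNorm {d : ℕ} (Λ : Matrix (Fin d) (Fin d) ℝ) (v : Fin d → ℝ) : ℝ :=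
  √(v ⬝ᵥ (Λ *ᵥ v))

/-- The `ε`-net `{nε : n = 0, 1, …, ⌊H/ε⌋}` of `[0, H]`. -/
def net (H : ℕ) (ε : ℝ) : Finset ℝ :=
  (Finset.range (⌊(H : ℝ) / ε⌋₊ + 1)).image (fun n : ℕ => (n : ℝ) * ε)

theorem net_nonempty (H : ℕ) (ε : ℝ) : (net H ε).Nonempty :=
  Finset.Nonempty.image ⟨0, by simp⟩ _

/-- What the agent is given: the rewards, the feature map, the risk level and the parameters of
the algorithm. The transition kernels are not part of it. -/
structure Input (S A : Type*) (H d : ℕ) where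
  r : Fin H → S → A → ℝ
  φ : S → S → A → Fin d → ℝ
  /-- risk level -/
  α : ℝ
  /-- approximation accuracy -/
  ε : ℝ
  /-- regularization parameter -/
  lam : ℝ
  /-- bonus multiplier -/
  β : ℝ

/-- Rules by which the two `argmax` operations of the algorithm break ties: `act` chooses a
maximizing action, `pt` a maximizing point of the net. They may depend on the past episodes, the
step and the current state. -/
structure TieBreak (S A : Type*) (H : ℕ) (ε : ℝ) where
  act : History S H → Fin H → S → (A → ℝ) → A
  act_max : ∀ hist h s (q : A → ℝ) a, q a ≤ q (act hist h s q)
  pt : History S H → Fin H → S → (ℝ → ℝ) → ℝ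
  pt_mem : ∀ hist h s (g : ℝ → ℝ), pt hist h s g ∈ net H ε
  pt_max : ∀ hist h s (g : ℝ → ℝ), ∀ x ∈ net H ε, g x ≤ g (pt hist h s g)

section Algorithm

variable {S A : Type*} {H d : ℕ}

/-- The approximated CVaR operator, with the supremum over the net. -/
def cvarNet (I : Input S A H d) (θ : Fin d → ℝ) (V : S → ℝ) (s : S) (a : A) : ℝ :=
  (net H I.ε).sup' (net_nonempty H I.ε)
    (fun x => x - 1 / I.α * (θ ⬝ᵥ psi I.φ (shortfall x V) s a))

/-- The norm of the CVaR-adapted feature in the metric of `Λ⁻¹`. -/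
def featureNorm (I : Input S A H d) (Λ : Matrix (Fin d) (Fin d) ℝ) (V : S → ℝ) (s : S) (a : A)
    (x : ℝ) : ℝ :=
  weightedNorm Λ⁻¹ (psi I.φ (shortfall x V) s a)

/-- The bonus term. -/
def bonus (I : Input S A H d) (Λ : Matrix (Fin d) (Fin d) ℝ) (V : S → ℝ) (s : S) (a : A) : ℝ :=
  I.β / I.α * (net H I.ε).sup' (net_nonempty H I.ε) (featureNorm I Λ V s a)

/-- The regression statistics of one step: the covariance matrix `Λ` and the vector
`∑ ψ y` of the regression (features times targets). -/
structure Stats (d : ℕ) where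
  Λ : Matrix (Fin d) (Fin d) ℝ
  b : Fin d → ℝ

/-- The ridge regression estimator `Λ⁻¹ ∑ ψ y`. -/
def Stats.θ {d : ℕ} (st : Stats d) : Fin d → ℝ := st.Λ⁻¹ *ᵥ st.b

/-- The optimistic Q-value function of step `h`, from the optimistic value function `V` of the
next step. -/
def optimisticQ (I : Input S A H d) (st : Stats d) (h : Fin H) (V : S → ℝ) (s : S) (a : A) : ℝ :=
  I.r h s a + cvarNet I st.θ V s a + 2 * I.ε + bonus I st.Λ V s a

/-- The optimistic value functions of one episode, backwards from `0` at step `H + 1`. -/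
def optimisticV [Fintype A] [Nonempty A] (I : Input S A H d) (st : Fin H → Stats d) :
    Fin (H + 1) → S → ℝ :=
  Fin.reverseInduction (motive := fun _ => S → ℝ) (fun _ => 0)
    (fun h Vnext s => min
      (Finset.univ.sup' Finset.univ_nonempty (fun a => optimisticQ I (st h) h Vnext s a)) (H : ℝ))

/-- The greedy policy of the episode that follows `hist`. -/
def greedyPolicy [Fintype A] [Nonempty A] (I : Input S A H d) (T : TieBreak S A H I.ε)
    (hist : History S H) (st : Fin H → Stats d) : Policy S A H :=
  fun h s => T.act hist h s (fun a => optimisticQ I (st h) h (optimisticV I st h.succ) s a)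

/-- The regression statistics of all steps after the episodes `hist`. -/
def stats [Fintype A] [Nonempty A] (I : Input S A H d) (T : TieBreak S A H I.ε) :
    History S H → Fin H → Stats d
  | [] => fun _ => ⟨I.lam • 1, 0⟩
  | ep :: hist => fun h =>
    let st := stats I T hist
    let V := optimisticV I st h.succ
    let s := ep h.castSucc
    let a := greedyPolicy I T hist st h s
    let x := T.pt hist h s (featureNorm I (st h).Λ V s a)
    let ψ := psi I.φ (shortfall x V) s a
    ⟨(st h).Λ + Matrix.vecMulVec ψ ψ, (st h).b + shortfall x V (ep h.succ) • ψ⟩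

/-- The policy played by ICVaR-L in the episode that follows `hist`. -/
def icvarL [Fintype A] [Nonempty A] (I : Input S A H d) (T : TieBreak S A H I.ε)
    (hist : History S H) : Policy S A H :=
  greedyPolicy I T hist (stats I T hist)

end Algorithm

/-- Law of the path of an inhomogeneous Markov chain with `n` transitions started at `s`. -/
def pathLaw {S : Type*} : (n : ℕ) → (Fin n → S → PMF S) → S → PMF (Fin (n + 1) → S)
  | 0, _, s => PMF.pure (fun _ => s)
  | n + 1, Q, s => (Q 0 s).bind fun s' =>
      (pathLaw n (fun i => Q i.succ) s').map (fun ω => (Fin.cons s ω : Fin (n + 2) → S))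

/-- Law of the first `k` episodes, when the environment chooses the initial states by `env`
(possibly at random and depending on the past) and the agent chooses policies by `alg`. -/
def runLaw {S A : Type*} {H : ℕ} (M : EpisodicMDP S A H) (env : History S H → PMF S)
    (alg : History S H → Policy S A H) : ℕ → PMF (History S H)
  | 0 => PMF.pure []
  | k + 1 => (runLaw M env alg k).bind fun hist => (env hist).bind fun s =>
      (pathLaw H (fun h s => M.P h s (alg hist h s)) s).map (fun ep => ep :: hist)

/-- The cumulative regret over the episodes of a history:
`∑_k (V_1^*(s_{k,1}) - V_1^{π^k}(s_{k,1}))`. -/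
def regret {S A : Type*} {H : ℕ} (α : ℝ) (M : EpisodicMDP S A H)
    (alg : History S H → Policy S A H) : History S H → ℝ
  | [] => 0
  | ep :: hist => (optimalValue α M 0 (ep 0) - policyValue α M (alg hist) 0 (ep 0))
      + regret α M alg hist

/-- `β̂ = H √(d log((H + K H³)/δ)) + √λ` -/
def betaHat (d H K : ℕ) (δ lam : ℝ) : ℝ :=
  (H : ℝ) * √((d : ℝ) * Real.log (((H : ℝ) + K * (H : ℝ) ^ 3) / δ)) + √lam

/-- The regret bound, in terms of the bonus multiplier `β`. -/
def regretBound (d H K : ℕ) (α δ β : ℝ) : ℝ :=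
  4 * d * (H : ℝ) ^ 2 * √(K : ℝ) / √(α ^ (H + 1)) +
    2 * β * √((K : ℝ) * H / α ^ (H + 1)) *
      √(8 * d * H * Real.log K + 4 * (H : ℝ) ^ 3 * Real.log ((4 * Real.logb 2 K + 8) / δ))

end ICVaR

end

namespace ICVaR

open scoped ENNReal

/-! The proof combines optimism with ridge regression. By the linear mixture assumption, expected
shortfalls are linear in the unknown parameter (`dotProduct_psi`), so each episode supplies one
noisy linear observation per step, with values in `[0, H]`.

Confidence: the self-normalized process `selfNormalized` is a nonnegative supermartingale
(`expect_selfNormalized_le`). Ville's inequality (`toOuterMeasure_exists_suffix_le`) and a union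
bound over the steps put the true parameters in all confidence ellipsoids at once, outside an event
of probability `δ`. The optimistic values then dominate the values of all policies, and their excess
over the values of the played policy is controlled by the bonuses.

Propagation of the bonuses: CVaR is translation equivariant, while an error in expectation costs a
factor `1/α` per step (`cvar_le_cvar_add`). Each bonus `b` is therefore split as `b ≤ c + b² /
(4c)`: the constant passes through CVaR at no cost, and only the squares collect powers of `1/α`
(`optimisticV_sub_policyValue_le`). Once `c` is optimized, these powers stand under the square root,
which gives `α^{-(H+1)/2}`.

Sum of squared widths: a second supermartingale, `widthProcess`, bounds the expected squared widths
by twice the realized ones plus a logarithm, outside another event of probability `δ`. The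
elliptical potential lemma `totalWidth_le` bounds the realized ones. It applies because the
algorithm updates with the very feature that maximizes the bonus (`width_eq`).

The rest is numerical: the radius of the ellipsoids is at most `betaHat`, and the sums fit in
`regretBound`. -/

/-- The expectation of a function with values in `[0, ∞]` under a discrete distribution. -/
noncomputable def expect {α : Type*} (p : PMF α) (f : α → ℝ≥0∞) : ℝ≥0∞ := ∑' a, p a * f a

/-! ### Expectations under discrete distributions, without measurability. -/

section Expect

variable {α β : Type*}

theorem expect_mono (p : PMF α) {f g : α → ℝ≥0∞} (h : ∀ a, f a ≤ g a) :
    expect p f ≤ expect p g :=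
  ENNReal.tsum_le_tsum fun a => mul_le_mul_right (h a) _

theorem expect_const (p : PMF α) (c : ℝ≥0∞) : expect p (fun _ => c) = c := by
  rw [expect, ENNReal.tsum_mul_right, p.tsum_coe, one_mul]

theorem expect_const_mul (p : PMF α) (c : ℝ≥0∞) (f : α → ℝ≥0∞) :
    expect p (fun a => c * f a) = c * expect p f := by
  rw [expect, expect, ← ENNReal.tsum_mul_left]
  exact tsum_congr fun a => by ring

theorem expect_add (p : PMF α) (f g : α → ℝ≥0∞) :
    expect p (fun a => f a + g a) = expect p f + expect p g := by
  rw [expect, expect, expect, ← ENNReal.tsum_add]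
  exact tsum_congr fun a => by ring

theorem expect_pure (a : α) (f : α → ℝ≥0∞) : expect (PMF.pure a) f = f a := by
  rw [expect, tsum_eq_single a]
  · simp
  · intro b hb
    simp [PMF.pure_apply_of_ne a b hb]

theorem expect_bind (p : PMF α) (q : α → PMF β) (f : β → ℝ≥0∞) :
    expect (p.bind q) f = expect p (fun a => expect (q a) f) := by
  simp only [expect, PMF.bind_apply, ← ENNReal.tsum_mul_right, ← ENNReal.tsum_mul_left]
  rw [ENNReal.tsum_comm]
  exact tsum_congr fun a => tsum_congr fun b => by ring

theorem expect_map (p : PMF α) (g : α → β) (f : β → ℝ≥0∞) :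
    expect (p.map g) f = expect p (fun a => f (g a)) := by
  rw [← PMF.bind_pure_comp, expect_bind]
  simp only [Function.comp_apply, expect_pure]

theorem expect_le_of_forall_le (p : PMF α) {f : α → ℝ≥0∞} {c : ℝ≥0∞} (h : ∀ a, f a ≤ c) :
    expect p f ≤ c :=
  (expect_mono p h).trans_eq (expect_const p c)

theorem mul_toOuterMeasure_le_expect (p : PMF α) (f : α → ℝ≥0∞) (c : ℝ≥0∞) :
    c * p.toOuterMeasure {a | c ≤ f a} ≤ expect p f := by
  rw [PMF.toOuterMeasure_apply, expect, ← ENNReal.tsum_mul_left]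
  refine ENNReal.tsum_le_tsum fun a => ?_
  by_cases ha : c ≤ f a
  · rw [Set.indicator_of_mem (by exact ha), mul_comm]
    exact mul_le_mul_right ha _
  · rw [Set.indicator_of_notMem (by exact ha), mul_zero]
    exact zero_le

theorem summable_toReal_mul (p : PMF α) {f : α → ℝ} {C : ℝ} (h : ∀ a, |f a| ≤ C) :
    Summable fun a => (p a).toReal * f a := by
  refine Summable.of_norm_bounded (g := fun a => (p a).toReal * C)
    ((ENNReal.summable_toReal p.tsum_coe_ne_top).mul_right C) fun a => ?_
  rw [Real.norm_eq_abs, abs_mul, abs_of_nonneg ENNReal.toReal_nonneg]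
  exact mul_le_mul_of_nonneg_left (h a) ENNReal.toReal_nonneg

theorem tsum_toReal (p : PMF α) : ∑' a, (p a).toReal = 1 := by
  rw [← ENNReal.tsum_toReal_eq fun a => p.apply_ne_top a, p.tsum_coe, ENNReal.toReal_one]

theorem expect_ofReal (p : PMF α) {f : α → ℝ} {C : ℝ} (h0 : ∀ a, 0 ≤ f a) (h : ∀ a, f a ≤ C) :
    expect p (fun a => ENNReal.ofReal (f a)) = ENNReal.ofReal (∑' a, (p a).toReal * f a) := by
  rw [ENNReal.ofReal_tsum_of_nonneg (fun a => mul_nonneg ENNReal.toReal_nonneg (h0 a))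
    (summable_toReal_mul p (C := C) fun a => abs_le.2 ⟨by linarith [h0 a, h a], h a⟩)]
  refine tsum_congr fun a => ?_
  rw [ENNReal.ofReal_mul ENNReal.toReal_nonneg, ENNReal.ofReal_toReal (p.apply_ne_top a)]

end Expect

/-! ### Functionals of a Markov path. -/

section PathLaw

variable {S : Type*}

theorem expect_pathLaw_zero (Q : Fin 0 → S → PMF S) (s : S) (f : (Fin 1 → S) → ℝ≥0∞) :
    expect (pathLaw 0 Q s) f = f fun _ => s := expect_pure _ _

theorem expect_pathLaw_succ {n : ℕ} (Q : Fin (n + 1) → S → PMF S) (s : S)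
    (f : (Fin (n + 2) → S) → ℝ≥0∞) :
    expect (pathLaw (n + 1) Q s) f = expect (Q 0 s) fun s' =>
      expect (pathLaw n (fun i => Q i.succ) s') fun ω => f (Fin.cons s ω : Fin (n + 2) → S) := by
  rw [pathLaw, expect_bind]
  simp only [expect_map]

/-- The path starts at `s` almost surely, so the two functions need to agree only there. -/
theorem expect_pathLaw_congr {n : ℕ} (Q : Fin n → S → PMF S) (s : S)
    {f g : (Fin (n + 1) → S) → ℝ≥0∞} (h : ∀ ω, ω 0 = s → f ω = g ω) :
    expect (pathLaw n Q s) f = expect (pathLaw n Q s) g := by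
  cases n with
  | zero =>
    rw [expect_pathLaw_zero, expect_pathLaw_zero]
    exact h _ rfl
  | succ n =>
    rw [expect_pathLaw_succ, expect_pathLaw_succ]
    congr with s'
    congr with ω
    exact h _ rfl

/-- If the conditional expectation of a function of a transition is bounded, so is its
expectation along the path. -/
theorem expect_pathLaw_transition_le {n : ℕ} (Q : Fin n → S → PMF S) (h : Fin n)
    (f : S → S → ℝ≥0∞) (c : ℝ≥0∞) (hf : ∀ s, expect (Q h s) (f s) ≤ c) (s : S) :
    expect (pathLaw n Q s) (fun ω => f (ω h.castSucc) (ω h.succ)) ≤ c := by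
  induction n generalizing s with
  | zero => exact h.elim0
  | succ n ih =>
    rw [expect_pathLaw_succ]
    refine Fin.cases ?_ (fun i => ?_) h (motive := fun h => (∀ s, expect (Q h s) (f s) ≤ c) →
      (expect (Q 0 s) fun s' => expect (pathLaw n (fun i => Q i.succ) s') fun ω =>
        f ((Fin.cons s ω : Fin (n + 2) → S) h.castSucc)
          ((Fin.cons s ω : Fin (n + 2) → S) h.succ)) ≤ c) hf
    · intro h0
      refine le_trans (expect_mono _ fun s' => ?_) (h0 s)
      rw [expect_pathLaw_congr (g := fun _ => f s s'), expect_const]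
      intro ω hω
      simp [hω]
    · intro hi
      refine expect_le_of_forall_le _ fun s' => ?_
      exact ih (fun i => Q i.succ) i hi s'

/-- The expectation of an additive functional of the path satisfies the Bellman equation. -/
theorem expect_pathLaw_sum {n : ℕ} (Q : Fin n → S → PMF S) (g : Fin n → S → ℝ≥0∞)
    (W : Fin (n + 1) → S → ℝ≥0∞) (hlast : ∀ s, W (Fin.last n) s = 0)
    (hW : ∀ h s, W h.castSucc s = g h s + expect (Q h s) (W h.succ)) (s : S) :
    expect (pathLaw n Q s) (fun ω => ∑ h, g h (ω h.castSucc)) = W 0 s := by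
  induction n generalizing s with
  | zero =>
    rw [expect_pathLaw_zero]
    simpa using (hlast s).symm
  | succ n ih =>
    rw [expect_pathLaw_succ, show W 0 s = W (Fin.castSucc 0) s from rfl, hW 0 s]
    have key : ∀ s', (expect (pathLaw n (fun i => Q i.succ) s') fun ω =>
        ∑ h : Fin (n + 1), g h ((Fin.cons s ω : Fin (n + 2) → S) h.castSucc)) =
        g 0 s + W (Fin.succ 0) s' := by
      intro s'
      have h1 := expect_add (pathLaw n (fun i => Q i.succ) s') (fun _ => g 0 s)
        (fun ω => ∑ h : Fin n, g h.succ (ω h.castSucc))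
      rw [expect_const, ih (fun i => Q i.succ) (fun i => g i.succ) (fun i => W i.succ) hlast
        (fun h s => hW h.succ s) s'] at h1
      rw [← show W (Fin.succ 0) s' = W (Fin.succ (0 : Fin (n + 1))) s' from rfl, ← h1]
      congr with ω
      rw [Fin.sum_univ_succ]
      rfl
    simp only [key]
    rw [expect_add, expect_const]

end PathLaw

/-! ### Supermartingales along the run and Ville's inequality. -/

section RunLaw

variable {S A : Type*} {H : ℕ} (M : EpisodicMDP S A H) (env : History S H → PMF S)
  (alg : History S H → Policy S A H)

/-- The law of the next episode, given the initial state and the past episodes. -/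
noncomputable def episodeLaw (hist : History S H) (s : S) : PMF (Episode S H) :=
  pathLaw H (fun h s => M.P h s (alg hist h s)) s

theorem expect_runLaw_succ (k : ℕ) (F : History S H → ℝ≥0∞) :
    expect (runLaw M env alg (k + 1)) F = expect (runLaw M env alg k) fun hist =>
      expect (env hist) fun s => expect (episodeLaw M alg hist s) fun ep => F (ep :: hist) := by
  rw [runLaw, expect_bind]
  simp only [expect_bind, expect_map]
  rfl

theorem expect_runLaw_le (F : History S H → ℝ≥0∞)
    (hF : ∀ hist s, (expect (episodeLaw M alg hist s) fun ep => F (ep :: hist)) ≤ F hist)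
    (k : ℕ) : expect (runLaw M env alg k) F ≤ F [] := by
  induction k with
  | zero => exact (expect_pure _ _).le
  | succ k ih =>
    rw [expect_runLaw_succ]
    exact (expect_mono _ fun hist => expect_le_of_forall_le _ fun s => hF hist s).trans ih

/-- **Ville's inequality** for a nonnegative supermartingale along the run. -/
theorem toOuterMeasure_exists_suffix_le (F : History S H → ℝ≥0∞) (c : ℝ≥0∞)
    (hF : ∀ hist s, (expect (episodeLaw M alg hist s) fun ep => F (ep :: hist)) ≤ F hist)
    (k : ℕ) :
    c * (runLaw M env alg k).toOuterMeasure {hist | ∃ l, l <:+ hist ∧ c ≤ F l} ≤ F [] := by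
  classical
  set bad : History S H → Prop := fun hist => ∃ l, l <:+ hist ∧ c ≤ F l with hbad
  -- `G` is the process stopped at its first crossing of the level `c` and capped there, still a
  -- supermartingale. Histories list the latest episode first, so earlier times are suffixes.
  let G : History S H → ℝ≥0∞ := fun hist => if bad hist then c else F hist
  have hcons : ∀ ep hist, bad (ep :: hist) ↔ c ≤ F (ep :: hist) ∨ bad hist := by
    intro ep hist
    simp only [hbad, List.suffix_cons_iff]
    constructor
    · rintro ⟨l, rfl | hl, h⟩
      · exact Or.inl h
      · exact Or.inr ⟨l, hl, h⟩
    · rintro (h | ⟨l, hl, h⟩)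
      · exact ⟨_, Or.inl rfl, h⟩
      · exact ⟨l, Or.inr hl, h⟩
  have hG : ∀ hist s, (expect (episodeLaw M alg hist s) fun ep => G (ep :: hist)) ≤ G hist := by
    intro hist s
    by_cases hb : bad hist
    · simp only [G, hcons, hb, or_true, if_true, expect_const, le_refl]
    · refine le_trans (expect_mono _ fun ep => ?_) ((hF hist s).trans_eq (by simp [G, hb]))
      simp only [G, hcons, hb, or_false]
      split_ifs with h
      · exact h
      · exact le_rfl
  have hG0 : G [] ≤ F [] := by
    simp only [G]
    split_ifs with h
    · obtain ⟨l, hl, h⟩ := h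
      rwa [List.suffix_nil.1 hl] at h
    · exact le_rfl
  refine le_trans (le_trans ?_ (mul_toOuterMeasure_le_expect _ G c))
    ((expect_runLaw_le M env alg G hG k).trans hG0)
  refine mul_le_mul_right ((runLaw M env alg k).toOuterMeasure.mono fun hist hb => ?_) _
  change c ≤ G hist
  exact (if_pos hb).ge

theorem length_of_mem_support_runLaw (k : ℕ) {hist : History S H}
    (h : hist ∈ (runLaw M env alg k).support) : hist.length = k := by
  induction k generalizing hist with
  | zero => simp_all [runLaw]
  | succ k ih =>
    simp only [runLaw, PMF.mem_support_bind_iff, PMF.mem_support_map_iff] at h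
    obtain ⟨l, hl, s, -, ep, -, rfl⟩ := h
    rw [List.length_cons, ih hl]

end RunLaw

/-! ### Quadratic forms, rank-one updates and determinants. -/

section LinearAlgebra

variable {d : ℕ}

theorem dotProduct_mulVec_comm {A : Matrix (Fin d) (Fin d) ℝ} (hA : A.IsHermitian)
    (u v : Fin d → ℝ) : u ⬝ᵥ (A *ᵥ v) = v ⬝ᵥ (A *ᵥ u) := by
  have hT : Aᵀ = A := hA
  rw [Matrix.dotProduct_mulVec, ← Matrix.mulVec_transpose, hT, dotProduct_comm]

theorem sq_weightedNorm {A : Matrix (Fin d) (Fin d) ℝ} (hA : A.PosSemidef) (v : Fin d → ℝ) :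
    weightedNorm A v ^ 2 = v ⬝ᵥ (A *ᵥ v) :=
  Real.sq_sqrt (by simpa using hA.dotProduct_mulVec_nonneg v)

theorem weightedNorm_nonneg (A : Matrix (Fin d) (Fin d) ℝ) (v : Fin d → ℝ) :
    0 ≤ weightedNorm A v := Real.sqrt_nonneg _

/-- Cauchy–Schwarz for a semidefinite form, from the discriminant of the nonnegative polynomial
obtained by evaluating the form at `u + t v`. -/
theorem abs_dotProduct_mulVec_le {A : Matrix (Fin d) (Fin d) ℝ} (hA : A.PosSemidef)
    (u v : Fin d → ℝ) : |u ⬝ᵥ (A *ᵥ v)| ≤ weightedNorm A u * weightedNorm A v := by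
  have key : ∀ t : ℝ, 0 ≤ (v ⬝ᵥ (A *ᵥ v)) * (t * t) + (2 * (u ⬝ᵥ (A *ᵥ v))) * t +
      u ⬝ᵥ (A *ᵥ u) := by
    intro t
    have h := hA.dotProduct_mulVec_nonneg (u + t • v)
    simp only [star_trivial, Matrix.mulVec_add, Matrix.mulVec_smul, add_dotProduct,
      dotProduct_add, smul_dotProduct, dotProduct_smul, smul_eq_mul,
      dotProduct_mulVec_comm hA.isHermitian v u] at h
    linarith
  have h := discrim_le_zero key
  rw [discrim, ← sq_weightedNorm hA, ← sq_weightedNorm hA] at h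
  refine abs_le_of_sq_le_sq ?_
    (mul_nonneg (weightedNorm_nonneg _ _) (weightedNorm_nonneg _ _))
  nlinarith

theorem vecMulVec_self_posSemidef (v : Fin d → ℝ) : (Matrix.vecMulVec v v).PosSemidef := by
  simpa using Matrix.posSemidef_vecMulVec_self_star v

theorem posDef_add_vecMulVec {A : Matrix (Fin d) (Fin d) ℝ} (hA : A.PosDef) (v : Fin d → ℝ) :
    (A + Matrix.vecMulVec v v).PosDef := hA.add_posSemidef (vecMulVec_self_posSemidef v)

theorem det_add_vecMulVec {A : Matrix (Fin d) (Fin d) ℝ} (hA : A.PosDef) (v : Fin d → ℝ) :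
    (A + Matrix.vecMulVec v v).det = A.det * (1 + v ⬝ᵥ (A⁻¹ *ᵥ v)) := by
  have h := Matrix.det_add_replicateCol_mul_replicateRow (ι := Unit)
    (A := A) (hA.isUnit.map Matrix.detMonoidHom) v v
  rw [← Matrix.vecMulVec_eq] at h
  rw [h]
  congr 2
  simp [Matrix.mul_apply, Matrix.mulVec, dotProduct, Finset.sum_mul, Finset.mul_sum]
  rw [Finset.sum_comm]
  simp [mul_assoc]

/-- The **Sherman–Morrison formula** for quadratic forms. -/
theorem dotProduct_inv_add_vecMulVec_mulVec {A : Matrix (Fin d) (Fin d) ℝ} (hA : A.PosDef)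
    (v u : Fin d → ℝ) :
    u ⬝ᵥ ((A + Matrix.vecMulVec v v)⁻¹ *ᵥ u) =
      u ⬝ᵥ (A⁻¹ *ᵥ u) - (u ⬝ᵥ (A⁻¹ *ᵥ v)) ^ 2 / (1 + v ⬝ᵥ (A⁻¹ *ᵥ v)) := by
  have hw : 0 ≤ v ⬝ᵥ (A⁻¹ *ᵥ v) := by
    simpa using hA.inv.posSemidef.dotProduct_mulVec_nonneg v
  have hdet : IsUnit A.det := hA.isUnit.map Matrix.detMonoidHom
  have hdet' : IsUnit (A + Matrix.vecMulVec v v).det :=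
    (posDef_add_vecMulVec hA v).isUnit.map Matrix.detMonoidHom
  -- The inverse is never computed: the candidate is checked to solve the linear system.
  have hsol : (A + Matrix.vecMulVec v v) *ᵥ
      (A⁻¹ *ᵥ u - ((u ⬝ᵥ (A⁻¹ *ᵥ v)) / (1 + v ⬝ᵥ (A⁻¹ *ᵥ v))) • (A⁻¹ *ᵥ v)) = u := by
    have hcancel : ∀ x, A *ᵥ (A⁻¹ *ᵥ x) = x := fun x => by
      rw [Matrix.mulVec_mulVec, Matrix.mul_nonsing_inv _ hdet, Matrix.one_mulVec]
    rw [Matrix.mulVec_sub, Matrix.mulVec_smul, Matrix.add_mulVec, Matrix.add_mulVec,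
      hcancel, hcancel, Matrix.vecMulVec_mulVec, Matrix.vecMulVec_mulVec,
      dotProduct_mulVec_comm hA.inv.isHermitian u v]
    ext i
    simp only [Pi.sub_apply, Pi.add_apply, Pi.smul_apply, smul_eq_mul, MulOpposite.smul_eq_mul_unop,
      MulOpposite.unop_op]
    field_simp
    ring
  have hinv : (A + Matrix.vecMulVec v v)⁻¹ *ᵥ u =
      A⁻¹ *ᵥ u - ((u ⬝ᵥ (A⁻¹ *ᵥ v)) / (1 + v ⬝ᵥ (A⁻¹ *ᵥ v))) • (A⁻¹ *ᵥ v) := by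
    conv_lhs => rw [← hsol]
    rw [Matrix.mulVec_mulVec, Matrix.nonsing_inv_mul _ hdet', Matrix.one_mulVec]
  rw [hinv, dotProduct_sub, dotProduct_smul, smul_eq_mul]
  ring

/-- The rank-one update of the quadratic form of the inverse. -/
theorem add_smul_dotProduct_inv_add_vecMulVec_mulVec {A : Matrix (Fin d) (Fin d) ℝ}
    (hA : A.PosDef) (v u : Fin d → ℝ) (η : ℝ) :
    (u + η • v) ⬝ᵥ ((A + Matrix.vecMulVec v v)⁻¹ *ᵥ (u + η • v)) =
      u ⬝ᵥ (A⁻¹ *ᵥ u) + (2 * η * (u ⬝ᵥ (A⁻¹ *ᵥ v)) + η ^ 2 * (v ⬝ᵥ (A⁻¹ *ᵥ v)) -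
        (u ⬝ᵥ (A⁻¹ *ᵥ v)) ^ 2) / (1 + v ⬝ᵥ (A⁻¹ *ᵥ v)) := by
  have hw : 0 ≤ v ⬝ᵥ (A⁻¹ *ᵥ v) := by
    simpa using hA.inv.posSemidef.dotProduct_mulVec_nonneg v
  rw [dotProduct_inv_add_vecMulVec_mulVec hA]
  simp only [Matrix.mulVec_add, Matrix.mulVec_smul, add_dotProduct, dotProduct_add,
    smul_dotProduct, dotProduct_smul, smul_eq_mul,
    dotProduct_mulVec_comm hA.inv.isHermitian v u]
  field_simp
  ring

/-- The inverse of a positive definite matrix that dominates `c` times the identity. -/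
theorem dotProduct_inv_mulVec_le {A : Matrix (Fin d) (Fin d) ℝ} (hA : A.PosDef) {c : ℝ}
    (hc : 0 < c) (h : ∀ v : Fin d → ℝ, c * (v ⬝ᵥ v) ≤ v ⬝ᵥ (A *ᵥ v)) (v : Fin d → ℝ) :
    v ⬝ᵥ (A⁻¹ *ᵥ v) ≤ v ⬝ᵥ v / c := by
  have hdet : IsUnit A.det := hA.isUnit.map Matrix.detMonoidHom
  set u := A⁻¹ *ᵥ v with hu
  have hAu : A *ᵥ u = v := by
    rw [hu, Matrix.mulVec_mulVec, Matrix.mul_nonsing_inv _ hdet, Matrix.one_mulVec]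
  have h1 := h u
  rw [hAu, dotProduct_comm u v] at h1
  -- Expanding this square and using `c |u|² ≤ u · v` from `h1` leaves `c (u · v) ≤ |v|²`.
  have h2 : 0 ≤ (v - c • u) ⬝ᵥ (v - c • u) := by
    simpa using dotProduct_star_self_nonneg (v - c • u)
  simp only [sub_dotProduct, dotProduct_sub, smul_dotProduct, dotProduct_smul, smul_eq_mul,
    dotProduct_comm u v] at h2
  rw [le_div_iff₀ hc]
  nlinarith

/-- AM–GM for the eigenvalues. -/
theorem det_le_trace_div_pow {A : Matrix (Fin d) (Fin d) ℝ} (hA : A.PosDef) (hd : 0 < d) :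
    A.det ≤ (A.trace / d) ^ d := by
  have hd' : (0 : ℝ) < d := by exact_mod_cast hd
  have h1 : A.det = ∏ i, hA.isHermitian.eigenvalues i := by
    simpa using hA.isHermitian.det_eq_prod_eigenvalues
  have h2 : A.trace = ∑ i, hA.isHermitian.eigenvalues i := by
    simpa using hA.isHermitian.trace_eq_sum_eigenvalues
  rw [h1, h2]
  have h3 := Real.geom_mean_le_arith_mean Finset.univ (fun _ => 1) hA.isHermitian.eigenvalues
    (by simp) (by simpa using hd) fun i _ => (hA.eigenvalues_pos i).le
  simp only [Real.rpow_one, one_mul, Finset.sum_const, Finset.card_univ, Fintype.card_fin,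
    nsmul_eq_mul, mul_one] at h3
  have h4 := pow_le_pow_left₀ (Real.rpow_nonneg (Finset.prod_nonneg fun i _ =>
    (hA.eigenvalues_pos i).le) _) h3 d
  rwa [← Real.rpow_natCast (_ ^ _) d, ← Real.rpow_mul (Finset.prod_nonneg fun i _ =>
    (hA.eigenvalues_pos i).le), inv_mul_cancel₀ hd'.ne', Real.rpow_one] at h4

end LinearAlgebra

/-! ### Exponentials of quadratics of a sub-Gaussian variable. -/

section SubGaussian

open MeasureTheory ProbabilityTheory

/-- Completing the square: tilting by `exp(z²/2)` lowers the precision from `(1 + v)/v` to `1/v`,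
which turns the first Gaussian into the second up to a constant. -/
theorem exp_sq_mul_gaussianPDFReal {v c : ℝ} (hv : 0 < v) (z : ℝ) :
    Real.exp (z ^ 2 / 2) * gaussianPDFReal (c / (1 + v)) (v / (1 + v)).toNNReal z =
      √(1 + v) * Real.exp (c ^ 2 / (2 * (1 + v))) * gaussianPDFReal c v.toNNReal z := by
  have hv1 : 0 < 1 + v := by linarith
  rw [gaussianPDFReal, gaussianPDFReal, Real.coe_toNNReal _ (by positivity),
    Real.coe_toNNReal _ hv.le]
  have h1 : (√(2 * Real.pi * (v / (1 + v))))⁻¹ = √(1 + v) * (√(2 * Real.pi * v))⁻¹ := by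
    rw [← mul_div_assoc, Real.sqrt_div (by positivity), inv_div, div_eq_mul_inv]
  rw [h1]
  have h2 : Real.exp (z ^ 2 / 2) * Real.exp (-(z - c / (1 + v)) ^ 2 / (2 * (v / (1 + v)))) =
      Real.exp (c ^ 2 / (2 * (1 + v))) * Real.exp (-(z - c) ^ 2 / (2 * v)) := by
    rw [← Real.exp_add, ← Real.exp_add]
    congr 1
    field_simp
    ring
  linear_combination (√(1 + v) * (√(2 * Real.pi * v))⁻¹) * h2

theorem lintegral_exp_sq_gaussianReal {v c : ℝ} (hv : 0 < v) :
    ∫⁻ z, ENNReal.ofReal (Real.exp (z ^ 2 / 2))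
        ∂gaussianReal (c / (1 + v)) (v / (1 + v)).toNNReal =
      ENNReal.ofReal (√(1 + v) * Real.exp (c ^ 2 / (2 * (1 + v)))) := by
  have hv1 : 0 < 1 + v := by linarith
  have hq : (v / (1 + v)).toNNReal ≠ 0 := by
    simpa [Real.toNNReal_eq_zero] using by positivity
  rw [gaussianReal_of_var_ne_zero _ hq, lintegral_withDensity_eq_lintegral_mul _
    (measurable_gaussianPDF _ _) (by fun_prop)]
  have h : ∀ z, (gaussianPDF (c / (1 + v)) (v / (1 + v)).toNNReal *
      fun z => ENNReal.ofReal (Real.exp (z ^ 2 / 2))) z =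
      ENNReal.ofReal (√(1 + v) * Real.exp (c ^ 2 / (2 * (1 + v)))) *
        gaussianPDF c v.toNNReal z := by
    intro z
    rw [Pi.mul_apply, gaussianPDF, gaussianPDF, ← ENNReal.ofReal_mul (gaussianPDFReal_nonneg _ _ _),
      ← ENNReal.ofReal_mul (by positivity), mul_comm, exp_sq_mul_gaussianPDFReal hv]
  simp only [h]
  rw [lintegral_const_mul _ (measurable_gaussianPDF _ _), lintegral_gaussianPDF_eq_one _
    (by simpa [Real.toNNReal_eq_zero] using hv), mul_one]

theorem lintegral_exp_mul_gaussianReal (m : ℝ) (q : NNReal) (t : ℝ) :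
    ∫⁻ z, ENNReal.ofReal (Real.exp (t * z)) ∂gaussianReal m q =
      ENNReal.ofReal (Real.exp (m * t + q * t ^ 2 / 2)) := by
  rw [← ofReal_integral_eq_lintegral_ofReal (integrable_exp_mul_gaussianReal t)
    (ae_of_all _ fun z => (Real.exp_pos _).le)]
  congr 1
  exact congrFun mgf_fun_id_gaussianReal t

/-- The exponential of a quadratic function of a sub-Gaussian random variable. -/
theorem lintegral_exp_quadratic_le {Ω : Type*} [MeasurableSpace Ω] {μ : Measure Ω}
    [IsProbabilityMeasure μ] {X : Ω → ℝ} (hX : Measurable X) (hsub : HasSubgaussianMGF X 1 μ)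
    {v : ℝ} (hv : 0 ≤ v) (c : ℝ) :
    ∫⁻ ω, ENNReal.ofReal
        (Real.exp ((2 * X ω * c + X ω ^ 2 * v - c ^ 2) / (2 * (1 + v)))) ∂μ ≤
      ENNReal.ofReal (√(1 + v)) := by
  have hmgf : ∀ t, ∫⁻ ω, ENNReal.ofReal (Real.exp (t * X ω)) ∂μ ≤
      ENNReal.ofReal (Real.exp (t ^ 2 / 2)) := by
    intro t
    rw [← ofReal_integral_eq_lintegral_ofReal (hsub.integrable_exp_mul t)
      (ae_of_all _ fun z => (Real.exp_pos _).le)]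
    refine ENNReal.ofReal_le_ofReal ((hsub.mgf_le t).trans_eq ?_)
    simp
  have hv1 : 0 < 1 + v := by linarith
  rcases hv.eq_or_lt with rfl | hv0
  -- For `v = 0` the mixing Gaussian below degenerates to a point mass without density, and the
  -- bound is the moment generating function at `c`.
  · have h : ∀ ω, ENNReal.ofReal
        (Real.exp ((2 * X ω * c + X ω ^ 2 * 0 - c ^ 2) / (2 * (1 + 0)))) =
        ENNReal.ofReal (Real.exp (-(c ^ 2 / 2))) * ENNReal.ofReal (Real.exp (c * X ω)) := by
      intro ω
      rw [← ENNReal.ofReal_mul (Real.exp_pos _).le, ← Real.exp_add]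
      congr 2
      ring
    simp only [h]
    rw [lintegral_const_mul _ (by fun_prop)]
    refine (mul_le_mul_right (hmgf c) _).trans_eq ?_
    rw [← ENNReal.ofReal_mul (Real.exp_pos _).le, ← Real.exp_add]
    simp
  -- Mean and variance are chosen so that averaging `exp(X z)` over `z` reproduces the quadratic
  -- exponent in `X`. After swapping the integrals, only the linear exponential moment of `X` is
  -- needed.
  · set γ := gaussianReal (c / (1 + v)) (v / (1 + v)).toNNReal with hγ
    set K := ENNReal.ofReal (Real.exp (-(c ^ 2 / (2 * (1 + v))))) with hK
    have h : ∀ ω, ENNReal.ofReal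
        (Real.exp ((2 * X ω * c + X ω ^ 2 * v - c ^ 2) / (2 * (1 + v)))) =
        K * ∫⁻ z, ENNReal.ofReal (Real.exp (X ω * z)) ∂γ := by
      intro ω
      rw [hγ, hK, lintegral_exp_mul_gaussianReal, ← ENNReal.ofReal_mul (Real.exp_pos _).le,
        ← Real.exp_add, Real.coe_toNNReal _ (by positivity)]
      congr 2
      field_simp
      ring
    simp only [h]
    have hmeas : Measurable (Function.uncurry fun ω z => ENNReal.ofReal (Real.exp (X ω * z))) := by
      unfold Function.uncurry
      fun_prop
    have hmeas' : Measurable fun ω => ∫⁻ z, ENNReal.ofReal (Real.exp (X ω * z)) ∂γ :=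
      hmeas.lintegral_prod_right'
    rw [lintegral_const_mul _ hmeas', lintegral_lintegral_swap
      hmeas.aemeasurable]
    have h2 : ∫⁻ z, ∫⁻ ω, ENNReal.ofReal (Real.exp (X ω * z)) ∂μ ∂γ ≤
        ∫⁻ z, ENNReal.ofReal (Real.exp (z ^ 2 / 2)) ∂γ := by
      refine lintegral_mono fun z => ?_
      simpa only [mul_comm] using hmgf z
    refine (mul_le_mul_right h2 _).trans_eq ?_
    rw [lintegral_exp_sq_gaussianReal hv0, hK, ← ENNReal.ofReal_mul (Real.exp_pos _).le]
    congr 1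
    rw [mul_comm, mul_assoc, ← Real.exp_add]
    simp

end SubGaussian

/-! ### Transfer of the sub-Gaussian bound to discrete distributions. -/

section Discrete

open MeasureTheory ProbabilityTheory

variable {S : Type*}

theorem expect_eq_lintegral (p : PMF S) (f : S → ℝ≥0∞) :
    letI : MeasurableSpace S := ⊤
    expect p f = ∫⁻ s, f s ∂p.toMeasure := by
  let _ : MeasurableSpace S := ⊤
  -- Writing the measure as a sum of weighted point masses requires no countability of `S`.
  have h : p.toMeasure = Measure.sum fun a => p a • Measure.dirac a := by
    ext s hs
    rw [PMF.toMeasure_apply _ hs, Measure.sum_apply _ hs]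
    refine tsum_congr fun a => ?_
    rw [Measure.smul_apply, Measure.dirac_apply' _ hs]
    by_cases ha : a ∈ s <;> simp [ha]
  change expect p f = ∫⁻ s, f s ∂p.toMeasure
  rw [h, lintegral_sum_measure]
  refine tsum_congr fun a => ?_
  rw [lintegral_smul_measure, lintegral_dirac' _ measurable_from_top, smul_eq_mul]

/-- A one-step bound for self-normalized sums: a variable with values in `[0, b]`, centred and
divided by `b / 2`, is sub-Gaussian. -/
theorem expect_exp_quadratic_le (p : PMF S) {y : S → ℝ} {b : ℝ} (hb : 0 < b)
    (hy : ∀ s, y s ∈ Set.Icc 0 b) {v : ℝ} (hv : 0 ≤ v) (c : ℝ) :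
    expect p (fun s => ENNReal.ofReal (Real.exp
      ((2 * ((2 / b) * (y s - ∑' s, (p s).toReal * y s)) * c +
        ((2 / b) * (y s - ∑' s, (p s).toReal * y s)) ^ 2 * v - c ^ 2) / (2 * (1 + v))))) ≤
      ENNReal.ofReal (√(1 + v)) := by
  let _ : MeasurableSpace S := ⊤
  have hmeas : Measurable y := measurable_from_top
  have hint : Integrable y p.toMeasure :=
    Integrable.of_mem_Icc 0 b hmeas.aemeasurable (ae_of_all _ hy)
  have h1 := hasSubgaussianMGF_of_mem_Icc (μ := p.toMeasure) hmeas.aemeasurable (ae_of_all _ hy)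
  have hmean : p.toMeasure[y] = ∑' s, (p s).toReal * y s := by
    simpa using PMF.integral_eq_tsum p y hint
  rw [hmean] at h1
  have h2 := h1.const_mul (2 / b)
  have h3 : HasSubgaussianMGF (fun s => (2 / b) * (y s - ∑' s, (p s).toReal * y s)) 1
      p.toMeasure := by
    convert h2 using 1
    ext
    change (1 : ℝ) = (2 / b) ^ 2 * (‖b - 0‖ / 2) ^ 2
    rw [sub_zero, Real.norm_of_nonneg hb.le]
    field_simp
  rw [expect_eq_lintegral]
  exact lintegral_exp_quadratic_le measurable_from_top h3 hv c

end Discrete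

/-! ### Stability of CVaR and its approximation on the net. -/

section Cvar

variable {S : Type*}

theorem shortfall_nonneg (x : ℝ) (V : S → ℝ) (s : S) : 0 ≤ shortfall x V s := le_max_right _ _

theorem shortfall_mem_Icc {x : ℝ} {V : S → ℝ} {C : ℝ} (hx0 : 0 ≤ x) (hx : x ≤ C)
    (hV : ∀ s, 0 ≤ V s) (s : S) : shortfall x V s ∈ Set.Icc 0 C :=
  ⟨shortfall_nonneg _ _ _, max_le (by linarith [hV s]) (hx0.trans hx)⟩

/-- The expected shortfall below the level `x`. -/
noncomputable def expectedShortfall (p : PMF S) (V : S → ℝ) (x : ℝ) : ℝ :=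
  ∑' s, (p s).toReal * shortfall x V s

variable (p : PMF S) {V : S → ℝ} {C : ℝ}

theorem summable_shortfall (hV : ∀ s, V s ∈ Set.Icc 0 C) (x : ℝ) :
    Summable fun s => (p s).toReal * shortfall x V s := by
  refine summable_toReal_mul p (C := |x|) fun s => ?_
  rw [abs_of_nonneg (shortfall_nonneg _ _ _)]
  exact max_le (by linarith [(hV s).1, le_abs_self x]) (abs_nonneg x)

theorem expectedShortfall_nonneg (x : ℝ) : 0 ≤ expectedShortfall p V x :=
  tsum_nonneg fun _ => mul_nonneg ENNReal.toReal_nonneg (shortfall_nonneg _ _ _)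

/-- Comparison of expectations of pointwise comparable bounded functions. -/
theorem tsum_toReal_mul_le {f g : S → ℝ} (hf : Summable fun s => (p s).toReal * f s)
    (hg : Summable fun s => (p s).toReal * g s) (h : ∀ s, f s ≤ g s) :
    ∑' s, (p s).toReal * f s ≤ ∑' s, (p s).toReal * g s :=
  hf.tsum_le_tsum (fun s => mul_le_mul_of_nonneg_left (h s) ENNReal.toReal_nonneg) hg

theorem summable_toReal_mul_const (c : ℝ) : Summable fun s => (p s).toReal * c :=
  (ENNReal.summable_toReal p.tsum_coe_ne_top).mul_right c

theorem tsum_toReal_mul_const (c : ℝ) : ∑' s, (p s).toReal * c = c := by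
  rw [tsum_mul_right, tsum_toReal, one_mul]

theorem expectedShortfall_mono (hV : ∀ s, V s ∈ Set.Icc 0 C) {x y : ℝ} (hxy : x ≤ y) :
    expectedShortfall p V x ≤ expectedShortfall p V y :=
  tsum_toReal_mul_le p (summable_shortfall p hV x) (summable_shortfall p hV y)
    fun _ => max_le_max_right _ (by linarith)

/-- Above the range of the variable, the expected shortfall has slope at least `1`. -/
theorem expectedShortfall_add_le (hV : ∀ s, V s ∈ Set.Icc 0 C) (x : ℝ) :
    expectedShortfall p V C + (x - C) ≤ expectedShortfall p V x := by
  rw [expectedShortfall, ← tsum_toReal_mul_const p (x - C),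
    ← (summable_shortfall p hV C).tsum_add (summable_toReal_mul_const p _)]
  simp only [← mul_add]
  refine tsum_toReal_mul_le p ?_ (summable_shortfall p hV x) fun s => ?_
  · simp only [mul_add]
    exact (summable_shortfall p hV C).add (summable_toReal_mul_const p _)
  · have h := (hV s).2
    rw [shortfall, max_eq_left (by linarith)]
    exact le_trans (by linarith) (le_max_left _ _)

theorem expectedShortfall_of_nonpos (hV : ∀ s, V s ∈ Set.Icc 0 C) {x : ℝ} (hx : x ≤ 0) :
    expectedShortfall p V x = 0 := by
  rw [expectedShortfall]
  simp only [shortfall]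
  simp_rw [fun s => max_eq_right (a := x - V s) (b := 0) (by linarith [(hV s).1])]
  simp

variable {α : ℝ}

/-- The function maximized in the definition of the conditional value at risk does not exceed
its maximum over the range of the variable. -/
theorem exists_mem_Icc_le (hα : α ∈ Set.Ioc (0 : ℝ) 1) (hC : 0 ≤ C)
    (hV : ∀ s, V s ∈ Set.Icc 0 C) (x : ℝ) : ∃ y ∈ Set.Icc 0 C,
      x - 1 / α * expectedShortfall p V x ≤ y - 1 / α * expectedShortfall p V y := by
  have hα1 : 1 ≤ 1 / α := (one_le_div hα.1).2 hα.2
  rcases le_total x 0 with hx | hx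
  · refine ⟨0, ⟨le_rfl, hC⟩, ?_⟩
    rw [expectedShortfall_of_nonpos p hV hx, expectedShortfall_of_nonpos p hV le_rfl]
    simpa using hx
  · rcases le_total x C with hx' | hx'
    · exact ⟨x, ⟨hx, hx'⟩, le_rfl⟩
    -- Above `C` the objective has slope at most `1 - 1/α ≤ 0`.
    · refine ⟨C, ⟨hC, le_rfl⟩, ?_⟩
      have h := expectedShortfall_add_le p hV x
      nlinarith

theorem bddAbove_cvar (hα : α ∈ Set.Ioc (0 : ℝ) 1) (hC : 0 ≤ C) (hV : ∀ s, V s ∈ Set.Icc 0 C) :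
    BddAbove (Set.range fun x : ℝ => x - 1 / α * ∑' s, (p s).toReal * shortfall x V s) := by
  refine ⟨C, ?_⟩
  rintro _ ⟨x, rfl⟩
  obtain ⟨y, hy, h⟩ := exists_mem_Icc_le p hα hC hV x
  refine h.trans ?_
  have := mul_nonneg (one_div_nonneg.2 hα.1.le) (expectedShortfall_nonneg p (V := V) y)
  linarith [hy.2]

theorem le_cvar (hα : α ∈ Set.Ioc (0 : ℝ) 1) (hC : 0 ≤ C) (hV : ∀ s, V s ∈ Set.Icc 0 C) (x : ℝ) :
    x - 1 / α * expectedShortfall p V x ≤ cvar α p V :=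
  le_ciSup (bddAbove_cvar p hα hC hV) x

theorem cvar_mem_Icc (hα : α ∈ Set.Ioc (0 : ℝ) 1) (hC : 0 ≤ C) (hV : ∀ s, V s ∈ Set.Icc 0 C) :
    cvar α p V ∈ Set.Icc 0 C := by
  constructor
  · have h := le_cvar p hα hC hV 0
    rwa [expectedShortfall_of_nonpos p hV le_rfl, mul_zero, sub_zero] at h
  · refine ciSup_le fun x => ?_
    obtain ⟨y, hy, h⟩ := exists_mem_Icc_le p hα hC hV x
    refine h.trans ?_
    have := mul_nonneg (one_div_nonneg.2 hα.1.le) (expectedShortfall_nonneg p (V := V) y)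
    linarith [hy.2]

/-- If `W` exceeds `V` by at most `z + G`, the conditional values at risk differ by at most
`z + E G / α`. -/
theorem cvar_le_cvar_add (hα : α ∈ Set.Ioc (0 : ℝ) 1) (hC : 0 ≤ C)
    (hV : ∀ s, V s ∈ Set.Icc 0 C) {W : S → ℝ} (hW : ∀ s, W s ∈ Set.Icc 0 C) {G : S → ℝ} {D : ℝ}
    (hG : ∀ s, G s ∈ Set.Icc 0 D) {z : ℝ} (h : ∀ s, W s ≤ V s + z + G s) :
    cvar α p W ≤ cvar α p V + z + 1 / α * ∑' s, (p s).toReal * G s := by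
  refine ciSup_le fun x => ?_
  -- Testing `V` at the shifted level `x - z` absorbs the constant exactly; only `G` pays the factor
  -- `1/α`.
  have h1 := le_cvar p hα hC hV (x - z)
  have hsG : Summable fun s => (p s).toReal * G s :=
    summable_toReal_mul p (C := D) fun s => by rw [abs_of_nonneg (hG s).1]; exact (hG s).2
  have h2 : expectedShortfall p V (x - z) ≤
      (∑' s, (p s).toReal * shortfall x W s) + ∑' s, (p s).toReal * G s := by
    rw [← (summable_shortfall p hW x).tsum_add hsG]
    simp only [← mul_add]
    refine tsum_toReal_mul_le p (summable_shortfall p hV _) ?_ fun s => ?_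
    · simp only [mul_add]
      exact (summable_shortfall p hW x).add hsG
    · refine max_le ?_ (add_nonneg (shortfall_nonneg _ _ _) (hG s).1)
      have : x - W s ≤ shortfall x W s := le_max_left _ _
      linarith [h s]
  have h3 := mul_le_mul_of_nonneg_left h2 (one_div_nonneg.2 hα.1.le)
  rw [mul_add] at h3
  linarith

theorem cvar_mono (hα : α ∈ Set.Ioc (0 : ℝ) 1) (hC : 0 ≤ C)
    (hV : ∀ s, V s ∈ Set.Icc 0 C) {W : S → ℝ} (hW : ∀ s, W s ∈ Set.Icc 0 C)
    (h : ∀ s, W s ≤ V s) : cvar α p W ≤ cvar α p V := by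
  simpa using cvar_le_cvar_add p hα hC hV hW (G := fun _ => 0) (D := 0) (z := 0) (by simp)
    (by simpa using h)

theorem mem_net {H : ℕ} {ε x : ℝ} (hε : 0 < ε) (hx : x ∈ net H ε) : x ∈ Set.Icc 0 (H : ℝ) := by
  simp only [net, Finset.mem_image, Finset.mem_range] at hx
  obtain ⟨n, hn, rfl⟩ := hx
  have h1 : (n : ℝ) ≤ ⌊(H : ℝ) / ε⌋₊ := by exact_mod_cast Nat.lt_succ_iff.1 hn
  have h2 := h1.trans (Nat.floor_le (by positivity))
  exact ⟨by positivity, (le_div_iff₀ hε).1 h2⟩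

theorem exists_mem_net {H : ℕ} {ε x : ℝ} (hε : 0 < ε) (hx : x ∈ Set.Icc 0 (H : ℝ)) :
    ∃ y ∈ net H ε, y ≤ x ∧ x ≤ y + ε := by
  refine ⟨⌊x / ε⌋₊ * ε, ?_, ?_, ?_⟩
  · simp only [net, Finset.mem_image, Finset.mem_range]
    refine ⟨_, Nat.lt_succ_of_le (Nat.floor_le_floor ?_), rfl⟩
    exact div_le_div_of_nonneg_right hx.2 hε.le
  · exact (le_div_iff₀ hε).1 (Nat.floor_le (div_nonneg hx.1 hε.le))
  · have h := (Nat.lt_floor_add_one (x / ε)).le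
    rw [div_le_iff₀ hε] at h
    linarith

/-- The conditional value at risk is approximated by the maximum over the net. -/
theorem exists_mem_net_cvar_le {H : ℕ} {ε : ℝ} (hα : α ∈ Set.Ioc (0 : ℝ) 1) (hε : 0 < ε)
    (hV : ∀ s, V s ∈ Set.Icc 0 (H : ℝ)) {B : ℝ}
    (hB : ∀ x ∈ net H ε, x - 1 / α * expectedShortfall p V x ≤ B) : cvar α p V ≤ B + ε := by
  refine ciSup_le fun x => ?_
  obtain ⟨y, hy, h⟩ := exists_mem_Icc_le p hα (Nat.cast_nonneg H) hV x
  -- Rounding down can only decrease the expected shortfall, so the loss is at most `ε` and carries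
  -- no factor `1/α`.
  obtain ⟨w, hw, hwy, hyw⟩ := exists_mem_net hε hy
  have h1 := mul_le_mul_of_nonneg_left (expectedShortfall_mono p hV hwy)
    (one_div_nonneg.2 hα.1.le)
  have h2 := hB w hw
  refine h.trans ?_
  linarith

end Cvar

/-! ### Integrated features as linear expectations. -/

section Features

variable {S A : Type*} {d H : ℕ} {φ : S → S → A → Fin d → ℝ}

theorem summable_psi (hφ : IsNormalizedFeature φ) {f : S → ℝ} {C : ℝ}
    (hf : ∀ s, f s ∈ Set.Icc 0 C) (s : S) (a : A) : Summable fun s' => f s' • φ s' s a := by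
  refine Summable.of_norm_bounded (g := fun s' => C * ‖φ s' s a‖)
    ((hφ s a).1.norm.mul_left C) fun s' => ?_
  rw [norm_smul, Real.norm_of_nonneg (hf s').1]
  exact mul_le_mul_of_nonneg_right (hf s').2 (norm_nonneg _)

/-- The point where the linear mixture assumption enters: expectations of bounded functions are
linear in `θ`, so the targets of the regression have conditional mean `⟨θ, ψ⟩`. -/
theorem dotProduct_psi (hφ : IsNormalizedFeature φ) {f : S → ℝ} {C : ℝ}
    (hf : ∀ s, f s ∈ Set.Icc 0 C) (s : S) (a : A) {θ : Fin d → ℝ} {p : PMF S}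
    (hθ : ∀ s', (p s').toReal = θ ⬝ᵥ φ s' s a) :
    θ ⬝ᵥ psi φ f s a = ∑' s', (p s').toReal * f s' := by
  have h := (summable_psi hφ hf s a).hasSum
  rw [psi]
  have h2 : HasSum (fun s' => (p s').toReal * f s') (θ ⬝ᵥ ∑' s', f s' • φ s' s a) := by
    rw [dotProduct]
    have := hasSum_sum (s := Finset.univ) (f := fun i s' => θ i * (f s' • φ s' s a) i)
      (a := fun i => θ i * (∑' s', f s' • φ s' s a) i)
      fun i _ => ((Pi.hasSum.1 h) i).mul_left (θ i)
    convert this using 1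
    ext s'
    rw [hθ, dotProduct, Finset.sum_mul]
    refine Finset.sum_congr rfl fun i _ => ?_
    rw [Pi.smul_apply, smul_eq_mul]
    ring
  exact h2.tsum_eq.symm

theorem dotProduct_self_eq_sq_norm (v : Fin d → ℝ) : v ⬝ᵥ v = ‖WithLp.toLp 2 v‖ ^ 2 := by
  rw [EuclideanSpace.norm_sq_eq]
  simp [dotProduct, sq]

/-- The normalization for functions with values in `[0, 1]`, rescaled by `C`. -/
theorem psi_dotProduct_self_le (hφ : IsNormalizedFeature φ) {f : S → ℝ} {C : ℝ} (hC : 0 < C)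
    (hf : ∀ s, f s ∈ Set.Icc 0 C) (s : S) (a : A) : psi φ f s a ⬝ᵥ psi φ f s a ≤ C ^ 2 := by
  have h1 := (hφ s a).2 (fun s' => f s' / C) fun s' =>
    ⟨div_nonneg (hf s').1 hC.le, (div_le_one hC).2 (hf s').2⟩
  have h2 : psi φ f s a = C • psi φ (fun s' => f s' / C) s a := by
    rw [psi, psi, ← tsum_const_smul'']
    refine tsum_congr fun s' => ?_
    rw [smul_smul, mul_div_cancel₀ _ hC.ne']
  rw [h2, smul_dotProduct, dotProduct_smul, dotProduct_self_eq_sq_norm, smul_eq_mul, smul_eq_mul]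
  have h3 := pow_le_pow_left₀ (norm_nonneg _) h1 2
  nlinarith [sq_nonneg C]

end Features

/-! ### Bellman recursions for the two value functions. -/

section Recursion

variable {S A : Type*} {H d : ℕ}

theorem policyValue_last (α : ℝ) (M : EpisodicMDP S A H) (π : Policy S A H) (s : S) :
    policyValue α M π (Fin.last H) s = 0 := by
  simp [policyValue]

theorem policyValue_castSucc (α : ℝ) (M : EpisodicMDP S A H) (π : Policy S A H) (h : Fin H)
    (s : S) : policyValue α M π h.castSucc s =
      M.r h s (π h s) + cvar α (M.P h s (π h s)) (policyValue α M π h.succ) := by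
  simp [policyValue]

variable [Fintype A] [Nonempty A]

theorem optimisticV_last (I : Input S A H d) (st : Fin H → Stats d) (s : S) :
    optimisticV I st (Fin.last H) s = 0 := by
  simp [optimisticV]

theorem optimisticV_castSucc (I : Input S A H d) (st : Fin H → Stats d) (h : Fin H) (s : S) :
    optimisticV I st h.castSucc s = min (Finset.univ.sup' Finset.univ_nonempty
      (fun a => optimisticQ I (st h) h (optimisticV I st h.succ) s a)) (H : ℝ) := by
  simp [optimisticV]

end Recursion

/-- The standing assumptions on the input of the algorithm. -/
structure Input.Valid {S A : Type*} {H d : ℕ} (I : Input S A H d) : Prop where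
  horizon_pos : 0 < H
  α_mem : I.α ∈ Set.Ioc (0 : ℝ) 1
  ε_pos : 0 < I.ε
  β_nonneg : 0 ≤ I.β
  r_nonneg : ∀ h s a, 0 ≤ I.r h s a
  lam_eq : I.lam = (H : ℝ) ^ 2
  normalized : IsNormalizedFeature I.φ

theorem Input.Valid.lam_pos {S A : Type*} {H d : ℕ} {I : Input S A H d}
    (hI : I.Valid) : 0 < I.lam := by
  have : (0 : ℝ) < H := by exact_mod_cast hI.horizon_pos
  rw [hI.lam_eq]
  positivity

/-! ### Regression statistics and the elliptical potential. -/

section Statistics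

variable {S A : Type*} [Fintype A] [Nonempty A] {H d : ℕ} (I : Input S A H d)
  (T : TieBreak S A H I.ε)

/-- The optimistic value function of the next step in the episode after `hist`. -/
noncomputable def nextV (hist : History S H) (h : Fin H) : S → ℝ :=
  optimisticV I (stats I T hist) h.succ

/-- The point of the net chosen by the algorithm in the state `s`. -/
noncomputable def netPoint (hist : History S H) (h : Fin H) (s : S) : ℝ :=
  T.pt hist h s (featureNorm I (stats I T hist h).Λ (nextV I T hist h) s (icvarL I T hist h s))

/-- The feature vector used by the algorithm in the state `s`. -/
noncomputable def feature (hist : History S H) (h : Fin H) (s : S) : Fin d → ℝ :=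
  psi I.φ (shortfall (netPoint I T hist h s) (nextV I T hist h)) s (icvarL I T hist h s)

theorem stats_cons_Λ (ep : Episode S H) (hist : History S H) (h : Fin H) :
    (stats I T (ep :: hist) h).Λ = (stats I T hist h).Λ +
      Matrix.vecMulVec (feature I T hist h (ep h.castSucc))
        (feature I T hist h (ep h.castSucc)) := rfl

theorem stats_cons_b (ep : Episode S H) (hist : History S H) (h : Fin H) :
    (stats I T (ep :: hist) h).b = (stats I T hist h).b +
      shortfall (netPoint I T hist h (ep h.castSucc)) (nextV I T hist h) (ep h.succ) •
        feature I T hist h (ep h.castSucc) := rfl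

theorem optimisticV_nonneg {I : Input S A H d} (hI : I.Valid) (st : Fin H → Stats d)
    (i : Fin (H + 1)) (s : S) : 0 ≤ optimisticV I st i s := by
  induction i using Fin.reverseInduction generalizing s with
  | last => rw [optimisticV_last]
  | cast h ih =>
    rw [optimisticV_castSucc]
    refine le_min ?_ (Nat.cast_nonneg H)
    obtain ⟨a⟩ := ‹Nonempty A›
    refine le_trans ?_ (Finset.le_sup' _ (Finset.mem_univ a))
    -- At the level `0` the shortfall of a nonnegative function vanishes, so the supremum over the
    -- net is nonnegative whatever the estimate of the parameter is.
    have h0 : (0 : ℝ) ∈ net H I.ε := by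
      simp only [net, Finset.mem_image, Finset.mem_range]
      exact ⟨0, by simp, by simp⟩
    have h1 : 0 ≤ cvarNet I (st h).θ (optimisticV I st h.succ) s a := by
      refine le_trans ?_ (Finset.le_sup' _ h0)
      have : shortfall 0 (optimisticV I st h.succ) = fun _ => 0 := by
        ext s'
        exact max_eq_right (by linarith [ih s'])
      simp [this, psi]
    have h2 : 0 ≤ bonus I (st h).Λ (optimisticV I st h.succ) s a :=
      mul_nonneg (div_nonneg hI.β_nonneg hI.α_mem.1.le)
        (le_trans (weightedNorm_nonneg _ _) (Finset.le_sup'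
          (featureNorm I (st h).Λ (optimisticV I st h.succ) s a) h0))
    have h3 := hI.r_nonneg h s a
    have h4 := hI.ε_pos
    rw [optimisticQ]
    linarith

theorem optimisticV_mem_Icc {I : Input S A H d} (hI : I.Valid) (st : Fin H → Stats d)
    (i : Fin (H + 1)) (s : S) : optimisticV I st i s ∈ Set.Icc 0 (H : ℝ) := by
  refine ⟨optimisticV_nonneg hI st i s, ?_⟩
  induction i using Fin.reverseInduction with
  | last => rw [optimisticV_last]; exact Nat.cast_nonneg H
  | cast h ih =>
    rw [optimisticV_castSucc]
    exact min_le_right _ _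

variable {I}

theorem netPoint_mem (hist : History S H) (h : Fin H) (s : S) :
    netPoint I T hist h s ∈ net H I.ε := T.pt_mem _ _ _ _

theorem shortfall_nextV_mem (hI : I.Valid) (hist : History S H) (h : Fin H) {x : ℝ}
    (hx : x ∈ net H I.ε) (s : S) :
    shortfall x (nextV I T hist h) s ∈ Set.Icc 0 (H : ℝ) :=
  shortfall_mem_Icc (mem_net hI.ε_pos hx).1 (mem_net hI.ε_pos hx).2
    (fun s' => optimisticV_nonneg hI _ _ s') s

theorem feature_dotProduct_self_le (hI : I.Valid) (hist : History S H) (h : Fin H) (s : S) :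
    feature I T hist h s ⬝ᵥ feature I T hist h s ≤ (H : ℝ) ^ 2 :=
  psi_dotProduct_self_le hI.normalized (by exact_mod_cast hI.horizon_pos)
    (shortfall_nextV_mem T hI hist h (netPoint_mem T hist h s)) _ _

theorem stats_Λ_sub_posSemidef (hist : History S H) (h : Fin H) :
    ((stats I T hist h).Λ - I.lam • 1).PosSemidef := by
  induction hist with
  | nil => simpa [stats] using Matrix.PosSemidef.zero
  | cons ep hist ih =>
    rw [stats_cons_Λ, add_sub_right_comm]
    exact ih.add (vecMulVec_self_posSemidef _)

theorem stats_Λ_posDef (hI : I.Valid) (hist : History S H) (h : Fin H) :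
    (stats I T hist h).Λ.PosDef := by
  have h1 := (Matrix.PosDef.one (n := Fin d) (R := ℝ)).smul hI.lam_pos
  have h2 := h1.add_posSemidef (stats_Λ_sub_posSemidef T hist h)
  simpa using h2

theorem lam_mul_le_stats_Λ (hist : History S H) (h : Fin H) (v : Fin d → ℝ) :
    I.lam * (v ⬝ᵥ v) ≤ v ⬝ᵥ ((stats I T hist h).Λ *ᵥ v) := by
  have := (stats_Λ_sub_posSemidef T hist h).dotProduct_mulVec_nonneg v
  simp only [star_trivial, Matrix.sub_mulVec, Matrix.smul_mulVec, Matrix.one_mulVec,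
    dotProduct_sub, dotProduct_smul, smul_eq_mul] at this
  linarith

theorem sq_weightedNorm_inv_stats_le (hI : I.Valid) (hist : History S H) (h : Fin H)
    (v : Fin d → ℝ) : weightedNorm (stats I T hist h).Λ⁻¹ v ^ 2 ≤ v ⬝ᵥ v / I.lam := by
  rw [sq_weightedNorm (stats_Λ_posDef T hI hist h).inv.posSemidef]
  exact dotProduct_inv_mulVec_le (stats_Λ_posDef T hI hist h) hI.lam_pos
    (lam_mul_le_stats_Λ T hist h) v

theorem trace_stats_Λ_le (hI : I.Valid) (hist : History S H) (h : Fin H) :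
    (stats I T hist h).Λ.trace ≤ I.lam * (d + hist.length) := by
  induction hist with
  | nil => simp [stats]
  | cons ep hist ih =>
    rw [stats_cons_Λ, Matrix.trace_add, Matrix.trace_vecMulVec, List.length_cons]
    have := feature_dotProduct_self_le T hI hist h (ep h.castSucc)
    rw [← hI.lam_eq] at this
    push_cast
    linarith

/-- The information gain of the regression at step `h`. -/
noncomputable def logDetRatio (I : Input S A H d) (T : TieBreak S A H I.ε) (hist : History S H)
    (h : Fin H) : ℝ :=
  Real.log ((stats I T hist h).Λ.det / I.lam ^ d)

theorem det_stats_nil (h : Fin H) : (stats I T [] h).Λ.det = I.lam ^ d := by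
  simp [stats]

/-- The trace grows by at most `λ = H²` per episode, and AM–GM turns the trace into a bound on the
determinant. -/
theorem logDetRatio_le (hI : I.Valid) (hd : 0 < d) (hist : History S H) (h : Fin H) :
    logDetRatio I T hist h ≤ d * Real.log (1 + hist.length / d) := by
  have hd' : (0 : ℝ) < d := by exact_mod_cast hd
  have hdet := (stats_Λ_posDef T hI hist h).det_pos
  have hlam := hI.lam_pos
  rw [logDetRatio, ← Real.log_pow]
  refine Real.log_le_log (by positivity) ?_
  rw [div_le_iff₀ (by positivity), ← mul_pow]
  refine (det_le_trace_div_pow (stats_Λ_posDef T hI hist h) hd).trans ?_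
  have h0 : 0 ≤ (stats I T hist h).Λ.trace := (stats_Λ_posDef T hI hist h).posSemidef.trace_nonneg
  refine pow_le_pow_left₀ (by positivity) ?_ d
  rw [div_le_iff₀ hd']
  refine (trace_stats_Λ_le T hI hist h).trans_eq ?_
  field_simp

/-- The largest norm of a feature in the state `s`, at the action of the algorithm. -/
noncomputable def width (I : Input S A H d) (T : TieBreak S A H I.ε) (hist : History S H)
    (h : Fin H) (s : S) : ℝ :=
  (net H I.ε).sup' (net_nonempty H I.ε)
    (featureNorm I (stats I T hist h).Λ (nextV I T hist h) s (icvarL I T hist h s))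

/-- The net point used in the update attains the maximum in the bonus. The bonus is thus measured by
the same vector that enters the covariance matrix, which makes the potential argument applicable. -/
theorem width_eq (hist : History S H) (h : Fin H) (s : S) :
    width I T hist h s = weightedNorm (stats I T hist h).Λ⁻¹ (feature I T hist h s) :=
  le_antisymm (Finset.sup'_le _ _ fun x hx => T.pt_max _ _ _ _ x hx)
    (Finset.le_sup' (featureNorm I (stats I T hist h).Λ (nextV I T hist h) s
      (icvarL I T hist h s)) (netPoint_mem T hist h s))

/-- The choice `λ = H²` matches the bound `H` on the features; without it the potential lemma would
need truncated widths. -/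
theorem sq_width_le_one (hI : I.Valid) (hist : History S H) (h : Fin H) (s : S) :
    width I T hist h s ^ 2 ≤ 1 := by
  rw [width_eq]
  refine (sq_weightedNorm_inv_stats_le T hI hist h _).trans ?_
  rw [div_le_one hI.lam_pos, hI.lam_eq]
  exact feature_dotProduct_self_le T hI hist h s

theorem det_stats_cons (hI : I.Valid) (ep : Episode S H) (hist : History S H) (h : Fin H) :
    (stats I T (ep :: hist) h).Λ.det =
      (stats I T hist h).Λ.det * (1 + width I T hist h (ep h.castSucc) ^ 2) := by
  rw [stats_cons_Λ, det_add_vecMulVec (stats_Λ_posDef T hI hist h), width_eq,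
    sq_weightedNorm (stats_Λ_posDef T hI hist h).inv.posSemidef]

theorem logDetRatio_nil (hI : I.Valid) (h : Fin H) : logDetRatio I T [] h = 0 := by
  rw [logDetRatio, det_stats_nil, div_self (pow_pos hI.lam_pos d).ne', Real.log_one]

theorem logDetRatio_cons (hI : I.Valid) (ep : Episode S H) (hist : History S H) (h : Fin H) :
    logDetRatio I T (ep :: hist) h =
      logDetRatio I T hist h + Real.log (1 + width I T hist h (ep h.castSucc) ^ 2) := by
  have hdet := (stats_Λ_posDef T hI hist h).det_pos
  have hlam := hI.lam_pos
  rw [logDetRatio, logDetRatio, det_stats_cons T hI, mul_div_right_comm,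
    Real.log_mul (by positivity) (by positivity)]

/-- The sum of the squared widths along the episode `ep`. -/
noncomputable def episodeWidth (I : Input S A H d) (T : TieBreak S A H I.ε) (hist : History S H)
    (ep : Episode S H) : ℝ :=
  ∑ h, width I T hist h (ep h.castSucc) ^ 2

/-- The sum of the squared widths along all past episodes. -/
noncomputable def totalWidth (I : Input S A H d) (T : TieBreak S A H I.ε) : History S H → ℝ
  | [] => 0
  | ep :: hist => episodeWidth I T hist ep + totalWidth I T hist

theorem le_two_mul_log_one_add {x : ℝ} (h0 : 0 ≤ x) (h1 : x ≤ 1) :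
    x ≤ 2 * Real.log (1 + x) := by
  have h := Real.one_sub_inv_le_log_of_pos (show 0 < 1 + x by linarith)
  have h2 : x / 2 ≤ 1 - (1 + x)⁻¹ := by
    have : 1 - (1 + x)⁻¹ = x / (1 + x) := by field_simp; ring
    rw [this]
    exact div_le_div_of_nonneg_left h0 (by linarith) (by linarith)
  linarith

/-- The **elliptical potential lemma**. -/
theorem totalWidth_le (hI : I.Valid) (hist : History S H) :
    totalWidth I T hist ≤ 2 * ∑ h, logDetRatio I T hist h := by
  induction hist with
  | nil => simp [totalWidth, logDetRatio_nil T hI]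
  | cons ep hist ih =>
    have : episodeWidth I T hist ep ≤
        2 * ∑ h, Real.log (1 + width I T hist h (ep h.castSucc) ^ 2) := by
      rw [episodeWidth, Finset.mul_sum]
      exact Finset.sum_le_sum fun h _ =>
        le_two_mul_log_one_add (sq_nonneg _) (sq_width_le_one T hI hist h _)
    simp only [totalWidth, logDetRatio_cons T hI, Finset.sum_add_distrib]
    linarith

theorem episodeWidth_mem (hI : I.Valid) (hist : History S H) (ep : Episode S H) :
    episodeWidth I T hist ep ∈ Set.Icc 0 (H : ℝ) := by
  refine ⟨Finset.sum_nonneg fun h _ => sq_nonneg _, ?_⟩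
  refine (Finset.sum_le_sum fun h _ => sq_width_le_one T hI hist h _).trans_eq ?_
  simp

end Statistics

/-! ### Confidence ellipsoids, and expected against realized widths. -/

section Concentration

variable {S A : Type*} [Fintype A] [Nonempty A] {H d : ℕ} {I : Input S A H d}
  (T : TieBreak S A H I.ε)

/-- The noise `∑ ψ (y - ⟨ψ, θ⟩)` accumulated by the regression at step `h`. -/
noncomputable def noise (T : TieBreak S A H I.ε) (θ : Fin d → ℝ) (hist : History S H)
    (h : Fin H) : Fin d → ℝ :=
  (stats I T hist h).b - ((stats I T hist h).Λ - I.lam • 1) *ᵥ θ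

theorem noise_nil (θ : Fin d → ℝ) (h : Fin H) : noise T θ [] h = 0 := by
  simp [noise, stats]

theorem noise_cons (θ : Fin d → ℝ) (ep : Episode S H) (hist : History S H) (h : Fin H) :
    noise T θ (ep :: hist) h = noise T θ hist h +
      (shortfall (netPoint I T hist h (ep h.castSucc)) (nextV I T hist h) (ep h.succ) -
        θ ⬝ᵥ feature I T hist h (ep h.castSucc)) • feature I T hist h (ep h.castSucc) := by
  simp only [noise, stats_cons_Λ, stats_cons_b, Matrix.add_mulVec, Matrix.sub_mulVec,
    Matrix.vecMulVec_mulVec, sub_smul]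
  rw [dotProduct_comm θ, op_smul_eq_smul]
  abel

/-- The self-normalized exponential process at step `h`. -/
noncomputable def selfNormalized (T : TieBreak S A H I.ε) (θ : Fin d → ℝ) (h : Fin H)
    (hist : History S H) : ℝ≥0∞ :=
  ENNReal.ofReal (Real.exp (-(logDetRatio I T hist h / 2) +
    ((2 / H : ℝ) • noise T θ hist h) ⬝ᵥ
      ((stats I T hist h).Λ⁻¹ *ᵥ ((2 / H : ℝ) • noise T θ hist h)) / 2))

theorem selfNormalized_nil (hI : I.Valid) (θ : Fin d → ℝ) (h : Fin H) :
    selfNormalized T θ h [] = 1 := by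
  simp [selfNormalized, noise_nil, logDetRatio_nil T hI]

/-- The increment is put in the form of `expect_exp_quadratic_le`: a determinant factor that depends
only on the past and the current state, times the exponential of a quadratic in the new noise. -/
theorem selfNormalized_cons (hI : I.Valid) (θ : Fin d → ℝ) (h : Fin H) (hist : History S H)
    (ep : Episode S H) : selfNormalized T θ h (ep :: hist) = selfNormalized T θ h hist *
      ENNReal.ofReal (Real.exp (-(Real.log (1 + width I T hist h (ep h.castSucc) ^ 2) / 2))) *
      ENNReal.ofReal (Real.exp
        ((2 * ((2 / H : ℝ) * (shortfall (netPoint I T hist h (ep h.castSucc)) (nextV I T hist h)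
              (ep h.succ) - θ ⬝ᵥ feature I T hist h (ep h.castSucc))) *
            (((2 / H : ℝ) • noise T θ hist h) ⬝ᵥ
              ((stats I T hist h).Λ⁻¹ *ᵥ feature I T hist h (ep h.castSucc))) +
          ((2 / H : ℝ) * (shortfall (netPoint I T hist h (ep h.castSucc)) (nextV I T hist h)
              (ep h.succ) - θ ⬝ᵥ feature I T hist h (ep h.castSucc))) ^ 2 *
            width I T hist h (ep h.castSucc) ^ 2 -
          (((2 / H : ℝ) • noise T θ hist h) ⬝ᵥ
              ((stats I T hist h).Λ⁻¹ *ᵥ feature I T hist h (ep h.castSucc))) ^ 2) /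
        (2 * (1 + width I T hist h (ep h.castSucc) ^ 2)))) := by
  have hΛ := stats_Λ_posDef T hI hist h
  rw [selfNormalized, noise_cons, smul_add, smul_smul, stats_cons_Λ,
    add_smul_dotProduct_inv_add_vecMulVec_mulVec hΛ, logDetRatio_cons T hI,
    ← sq_weightedNorm hΛ.inv.posSemidef (feature I T hist h (ep h.castSucc)), ← width_eq,
    selfNormalized, ← ENNReal.ofReal_mul (Real.exp_pos _).le, ← Real.exp_add,
    ← ENNReal.ofReal_mul (Real.exp_pos _).le, ← Real.exp_add]
  congr 2
  have : 0 < 1 + width I T hist h (ep h.castSucc) ^ 2 := by positivity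
  field_simp
  ring

variable (M : EpisodicMDP S A H)

/-- The one-step bound `√(1 + w²)` cancels exactly against the determinant factor. The scaling `2 /
H` makes noise with values in an interval of length `H` sub-Gaussian with parameter `1`. -/
theorem expect_selfNormalized_le (hI : I.Valid) (θ : Fin d → ℝ) (h : Fin H)
    (hθ : ∀ s' s a, (M.P h s a s').toReal = θ ⬝ᵥ I.φ s' s a) (hist : History S H) (s : S) :
    (expect (episodeLaw M (icvarL I T) hist s) fun ep => selfNormalized T θ h (ep :: hist)) ≤
      selfNormalized T θ h hist := by
  have hH : (0 : ℝ) < H := by exact_mod_cast hI.horizon_pos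
  simp only [selfNormalized_cons T hI]
  refine expect_pathLaw_transition_le _ h (fun s s' => selfNormalized T θ h hist *
      ENNReal.ofReal (Real.exp (-(Real.log (1 + width I T hist h s ^ 2) / 2))) *
      ENNReal.ofReal (Real.exp
        ((2 * ((2 / H : ℝ) * (shortfall (netPoint I T hist h s) (nextV I T hist h) s' -
              θ ⬝ᵥ feature I T hist h s)) *
            (((2 / H : ℝ) • noise T θ hist h) ⬝ᵥ
              ((stats I T hist h).Λ⁻¹ *ᵥ feature I T hist h s)) +
          ((2 / H : ℝ) * (shortfall (netPoint I T hist h s) (nextV I T hist h) s' -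
              θ ⬝ᵥ feature I T hist h s)) ^ 2 * width I T hist h s ^ 2 -
          (((2 / H : ℝ) • noise T θ hist h) ⬝ᵥ
              ((stats I T hist h).Λ⁻¹ *ᵥ feature I T hist h s)) ^ 2) /
        (2 * (1 + width I T hist h s ^ 2))))) _ (fun s => ?_) s
  have hy := shortfall_nextV_mem T hI hist h (netPoint_mem T hist h s)
  have hmean : θ ⬝ᵥ feature I T hist h s = _ :=
    dotProduct_psi hI.normalized hy s (icvarL I T hist h s) (fun s' => hθ s' s _)
  rw [expect_const_mul, mul_assoc, hmean]
  refine (mul_le_mul_right (mul_le_mul_right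
    (expect_exp_quadratic_le _ hH hy (sq_nonneg (width I T hist h s)) _) _) _).trans_eq ?_
  have h1 : 0 < 1 + width I T hist h s ^ 2 := by positivity
  rw [← ENNReal.ofReal_mul (Real.exp_pos _).le, Real.exp_neg, Real.exp_half,
    Real.exp_log h1, inv_mul_cancel₀ (Real.sqrt_pos.2 h1).ne', ENNReal.ofReal_one, mul_one]

/-- Outside of the exceptional event, the noise is bounded in the metric of the regression. -/
theorem weightedNorm_noise_le (hI : I.Valid) (θ : Fin d → ℝ) (h : Fin H) {c : ℝ} (hc : 0 < c)
    {hist : History S H} (hgood : ¬ ENNReal.ofReal c ≤ selfNormalized T θ h hist) :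
    weightedNorm (stats I T hist h).Λ⁻¹ (noise T θ hist h) ≤
      H / 2 * √(logDetRatio I T hist h + 2 * Real.log c) := by
  have hH : (0 : ℝ) < H := by exact_mod_cast hI.horizon_pos
  rw [selfNormalized, not_le, ENNReal.ofReal_lt_ofReal_iff hc, ← Real.lt_log_iff_exp_lt hc,
    Matrix.mulVec_smul, smul_dotProduct, dotProduct_smul,
    ← sq_weightedNorm (stats_Λ_posDef T hI hist h).inv.posSemidef, smul_eq_mul, smul_eq_mul]
    at hgood
  set w := weightedNorm (stats I T hist h).Λ⁻¹ (noise T θ hist h)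
  have h1 : (2 / H * w) ^ 2 ≤ logDetRatio I T hist h + 2 * Real.log c := by
    nlinarith
  have h2 := Real.le_sqrt_of_sq_le h1
  rw [div_mul_eq_mul_div, div_le_iff₀ hH] at h2
  linarith

/-- The estimation error of the regression in a given direction. -/
theorem abs_sub_dotProduct_le (hI : I.Valid) {θ : Fin d → ℝ} (hθ : ‖WithLp.toLp 2 θ‖ ≤ √(d : ℝ))
    (h : Fin H) (hist : History S H) (u : Fin d → ℝ) :
    |((stats I T hist h).θ - θ) ⬝ᵥ u| ≤
      (weightedNorm (stats I T hist h).Λ⁻¹ (noise T θ hist h) + H * √(d : ℝ)) *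
        weightedNorm (stats I T hist h).Λ⁻¹ u := by
  have hH : (0 : ℝ) < H := by exact_mod_cast hI.horizon_pos
  have hΛ := stats_Λ_posDef T hI hist h
  have hdet : IsUnit (stats I T hist h).Λ.det := hΛ.isUnit.map Matrix.detMonoidHom
  have h1 : (stats I T hist h).θ - θ = (stats I T hist h).Λ⁻¹ *ᵥ noise T θ hist h -
      I.lam • ((stats I T hist h).Λ⁻¹ *ᵥ θ) := by
    rw [noise, Stats.θ, Matrix.mulVec_sub, Matrix.mulVec_mulVec, mul_sub,
      Matrix.nonsing_inv_mul _ hdet, Matrix.sub_mulVec, Matrix.one_mulVec, mul_smul_comm, mul_one,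
      Matrix.smul_mulVec]
    abel
  have h2 : ((stats I T hist h).θ - θ) ⬝ᵥ u =
      u ⬝ᵥ ((stats I T hist h).Λ⁻¹ *ᵥ noise T θ hist h) -
        I.lam * (u ⬝ᵥ ((stats I T hist h).Λ⁻¹ *ᵥ θ)) := by
    rw [dotProduct_comm, h1, dotProduct_sub, dotProduct_smul, smul_eq_mul]
  have h3 := abs_dotProduct_mulVec_le hΛ.inv.posSemidef u (noise T θ hist h)
  have h4 := abs_dotProduct_mulVec_le hΛ.inv.posSemidef u θ
  -- The regularization bias: since `Λ ≥ λ`, it is at most `√λ ‖θ‖ ≤ H √d`.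
  have h5 : I.lam * weightedNorm (stats I T hist h).Λ⁻¹ θ ≤ H * √(d : ℝ) := by
    have h6 := sq_weightedNorm_inv_stats_le T hI hist h θ
    have h7 := pow_le_pow_left₀ (norm_nonneg _) hθ 2
    rw [← dotProduct_self_eq_sq_norm, Real.sq_sqrt (Nat.cast_nonneg d)] at h7
    rw [le_div_iff₀ hI.lam_pos, hI.lam_eq] at h6
    rw [hI.lam_eq, sq, mul_assoc]
    refine mul_le_mul_of_nonneg_left (Real.le_sqrt_of_sq_le ?_) hH.le
    nlinarith
  have hu := weightedNorm_nonneg (stats I T hist h).Λ⁻¹ u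
  rw [h2]
  refine (abs_sub _ _).trans ?_
  rw [abs_mul, abs_of_pos hI.lam_pos]
  have h8 := mul_le_mul_of_nonneg_left h4 hI.lam_pos.le
  have h9 := mul_le_mul_of_nonneg_right h5 hu
  linarith

/-- The expected sum of the squared widths from step `i` on, along an episode played by the
algorithm. -/
noncomputable def widthValue (T : TieBreak S A H I.ε) (M : EpisodicMDP S A H)
    (hist : History S H) : Fin (H + 1) → S → ℝ :=
  Fin.reverseInduction (motive := fun _ => S → ℝ) (fun _ => 0)
    (fun h Wnext s => width I T hist h s ^ 2 +
      ∑' s', (M.P h s (icvarL I T hist h s) s').toReal * Wnext s')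

theorem widthValue_last (hist : History S H) (s : S) :
    widthValue T M hist (Fin.last H) s = 0 := by
  simp [widthValue]

theorem widthValue_castSucc (hist : History S H) (h : Fin H) (s : S) :
    widthValue T M hist h.castSucc s = width I T hist h s ^ 2 +
      ∑' s', (M.P h s (icvarL I T hist h s) s').toReal * widthValue T M hist h.succ s' := by
  simp [widthValue]

theorem widthValue_mem_Icc (hI : I.Valid) (hist : History S H) (i : Fin (H + 1)) (s : S) :
    widthValue T M hist i s ∈ Set.Icc 0 ((H : ℝ) - (i : ℕ)) := by
  induction i using Fin.reverseInduction generalizing s with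
  | last => simp [widthValue_last]
  | cast h ih =>
    rw [widthValue_castSucc]
    have h1 := sq_width_le_one T hI hist h s
    have h2 : ∑' s', (M.P h s (icvarL I T hist h s) s').toReal * widthValue T M hist h.succ s' ≤
        (H : ℝ) - (h.succ : ℕ) := by
      rw [← tsum_toReal_mul_const (M.P h s (icvarL I T hist h s)) ((H : ℝ) - (h.succ : ℕ))]
      refine tsum_toReal_mul_le _ (summable_toReal_mul _ (C := (H : ℝ) - (h.succ : ℕ)) fun s' => ?_)
        (summable_toReal_mul_const _ _) fun s' => (ih s').2
      rw [abs_of_nonneg (ih s').1]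
      exact (ih s').2
    have h3 : 0 ≤ ∑' s', (M.P h s (icvarL I T hist h s) s').toReal *
        widthValue T M hist h.succ s' :=
      tsum_nonneg fun s' => mul_nonneg ENNReal.toReal_nonneg (ih s').1
    have h4 := sq_nonneg (width I T hist h s)
    simp only [Fin.val_succ, Fin.val_castSucc] at *
    push_cast at *
    constructor <;> linarith

/-- Links the backward recursion, which is what the regret decomposition produces, to the law of the
realized episode. -/
theorem expect_episodeWidth (hI : I.Valid) (hist : History S H) (s : S) :
    expect (episodeLaw M (icvarL I T) hist s)
      (fun ep => ENNReal.ofReal (episodeWidth I T hist ep)) =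
      ENNReal.ofReal (widthValue T M hist 0 s) := by
  have key := expect_pathLaw_sum (fun h s => M.P h s (icvarL I T hist h s))
    (fun h s => ENNReal.ofReal (width I T hist h s ^ 2))
    (fun i s => ENNReal.ofReal (widthValue T M hist i s))
    (fun s => by rw [widthValue_last, ENNReal.ofReal_zero]) (fun h s => by
      rw [expect_ofReal _ (fun s' => (widthValue_mem_Icc T M hI hist _ s').1)
        (fun s' => (widthValue_mem_Icc T M hI hist _ s').2), widthValue_castSucc,
        ENNReal.ofReal_add (sq_nonneg _) (tsum_nonneg fun s' =>
          mul_nonneg ENNReal.toReal_nonneg (widthValue_mem_Icc T M hI hist _ s').1)]) s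
  rw [← key, episodeLaw]
  congr with ep
  rw [episodeWidth, ENNReal.ofReal_sum_of_nonneg fun h _ => sq_nonneg _]

/-- The sum over the episodes of the conditionally expected squared widths. -/
noncomputable def totalWidthValue (T : TieBreak S A H I.ε) (M : EpisodicMDP S A H) :
    History S H → ℝ
  | [] => 0
  | ep :: hist => widthValue T M hist 0 (ep 0) + totalWidthValue T M hist

/-- The exponential process that compares the squared widths with their conditional
expectations. -/
noncomputable def widthProcess (T : TieBreak S A H I.ε) (M : EpisodicMDP S A H)
    (hist : History S H) : ℝ≥0∞ :=
  ENNReal.ofReal (Real.exp (totalWidthValue T M hist / (2 * H) - totalWidth I T hist / H))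

theorem exp_neg_le_one_sub_half {x : ℝ} (h0 : 0 ≤ x) (h1 : x ≤ 1) :
    Real.exp (-x) ≤ 1 - x / 2 := by
  rw [Real.exp_neg]
  have h2 := Real.quadratic_le_exp_of_nonneg h0
  refine (inv_anti₀ (by positivity) h2).trans ?_
  rw [inv_le_iff_one_le_mul₀ (by positivity)]
  nlinarith [mul_nonneg h0 (sub_nonneg.2 h1)]

/-- With `X` the width of the episode and `w` its conditional mean, `E exp(-X/H) ≤ 1 - w/(2H) ≤
exp(-w/(2H))`. The lost factor `2` explains the different scalings in `widthProcess` and the factor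
`2` in `totalWidthValue_le`. -/
theorem expect_widthProcess_le (hI : I.Valid) (hist : History S H) (s : S) :
    (expect (episodeLaw M (icvarL I T) hist s) fun ep => widthProcess T M (ep :: hist)) ≤
      widthProcess T M hist := by
  have hH : (0 : ℝ) < H := by exact_mod_cast hI.horizon_pos
  have hmem := widthValue_mem_Icc T M hI hist 0 s
  rw [Fin.val_zero, Nat.cast_zero, sub_zero] at hmem
  have h1 : (expect (episodeLaw M (icvarL I T) hist s) fun ep => widthProcess T M (ep :: hist)) =
      widthProcess T M hist * (ENNReal.ofReal (Real.exp (widthValue T M hist 0 s / (2 * H))) *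
        expect (episodeLaw M (icvarL I T) hist s)
          fun ep => ENNReal.ofReal (Real.exp (-(episodeWidth I T hist ep / H)))) := by
    rw [← expect_const_mul, ← expect_const_mul]
    refine expect_pathLaw_congr _ _ fun ep hep => ?_
    rw [widthProcess, widthProcess, totalWidthValue, totalWidth, hep,
      ← ENNReal.ofReal_mul (Real.exp_pos _).le, ← ENNReal.ofReal_mul (Real.exp_pos _).le,
      ← Real.exp_add, ← Real.exp_add]
    congr 2
    ring
  have h2 : expect (episodeLaw M (icvarL I T) hist s)
        (fun ep => ENNReal.ofReal (Real.exp (-(episodeWidth I T hist ep / H)))) ≤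
      ENNReal.ofReal (1 - widthValue T M hist 0 s / (2 * H)) := by
    -- The linear term is kept on the left so that no truncated subtraction occurs under the
    -- expectation.
    have h3 : expect (episodeLaw M (icvarL I T) hist s)
        (fun ep => ENNReal.ofReal (Real.exp (-(episodeWidth I T hist ep / H))) +
          ENNReal.ofReal (1 / (2 * H)) * ENNReal.ofReal (episodeWidth I T hist ep)) ≤ 1 := by
      refine expect_le_of_forall_le _ fun ep => ?_
      have h4 := episodeWidth_mem T hI hist ep
      have h5 := exp_neg_le_one_sub_half (div_nonneg h4.1 hH.le) ((div_le_one hH).2 h4.2)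
      rw [← ENNReal.ofReal_mul (by positivity), ← ENNReal.ofReal_add (Real.exp_pos _).le
        (mul_nonneg (by positivity) h4.1), ← ENNReal.ofReal_one]
      refine ENNReal.ofReal_le_ofReal ?_
      have h6 : 1 / (2 * H) * episodeWidth I T hist ep = episodeWidth I T hist ep / H / 2 := by
        field_simp
      linarith
    rw [expect_add, expect_const_mul, expect_episodeWidth T M hI,
      ← ENNReal.ofReal_mul (by positivity)] at h3
    rw [ENNReal.ofReal_sub _ (div_nonneg hmem.1 (by positivity)), ENNReal.ofReal_one]
    refine ENNReal.le_sub_of_add_le_right ENNReal.ofReal_ne_top ?_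
    convert h3 using 3
    ring
  rw [h1]
  refine (mul_le_mul_right (mul_le_mul_right h2 _) _).trans ?_
  rw [← ENNReal.ofReal_mul (Real.exp_pos _).le]
  refine mul_le_of_le_one_right' ?_
  rw [← ENNReal.ofReal_one]
  refine ENNReal.ofReal_le_ofReal ?_
  have h7 := Real.one_sub_le_exp_neg (widthValue T M hist 0 s / (2 * H))
  refine (mul_le_mul_of_nonneg_left h7 (Real.exp_pos _).le).trans_eq ?_
  rw [← Real.exp_add, add_neg_cancel, Real.exp_zero]

/-- Outside of the exceptional event, the expected squared widths are bounded by the realized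
ones. -/
theorem totalWidthValue_le (hI : I.Valid) {c : ℝ} (hc : 0 < c) {hist : History S H}
    (hgood : ¬ ENNReal.ofReal c ≤ widthProcess T M hist) :
    totalWidthValue T M hist ≤ 2 * totalWidth I T hist + 2 * H * Real.log c := by
  have hH : (0 : ℝ) < H := by exact_mod_cast hI.horizon_pos
  rw [widthProcess, not_le, ENNReal.ofReal_lt_ofReal_iff hc, ← Real.lt_log_iff_exp_lt hc,
    sub_lt_iff_lt_add, div_lt_iff₀ (by positivity)] at hgood
  refine hgood.le.trans_eq ?_
  field_simp
  ring

end Concentration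

/-! ### Optimism and the regret decomposition. -/

section Regret

variable {S A : Type*} {H d : ℕ}

theorem policyValue_mem_Icc {α : ℝ} (hα : α ∈ Set.Ioc (0 : ℝ) 1) (M : EpisodicMDP S A H)
    (π : Policy S A H) (i : Fin (H + 1)) (s : S) :
    policyValue α M π i s ∈ Set.Icc 0 ((H : ℝ) - (i : ℕ)) := by
  induction i using Fin.reverseInduction generalizing s with
  | last => simp [policyValue_last]
  | cast h ih =>
    have h0 : (0 : ℝ) ≤ (H : ℝ) - (h.succ : ℕ) := by
      rw [sub_nonneg, Nat.cast_le]
      exact Nat.lt_succ_iff.1 h.succ.2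
    have h1 := cvar_mem_Icc (M.P h s (π h s)) hα h0 ih
    have h2 := M.r_mem h s (π h s)
    rw [policyValue_castSucc]
    simp only [Fin.val_succ, Fin.val_castSucc, Set.mem_Icc] at *
    push_cast at *
    constructor <;> linarith

theorem policyValue_mem_Icc_horizon {α : ℝ} (hα : α ∈ Set.Ioc (0 : ℝ) 1)
    (M : EpisodicMDP S A H) (π : Policy S A H) (i : Fin (H + 1)) (s : S) :
    policyValue α M π i s ∈ Set.Icc 0 (H : ℝ) :=
  ⟨(policyValue_mem_Icc hα M π i s).1, (policyValue_mem_Icc hα M π i s).2.trans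
    (sub_le_self _ (Nat.cast_nonneg _))⟩

variable {I : Input S A H d}

/-- The parameter `θ` lies in the confidence ellipsoid of the statistics `st`. -/
def Stats.Confident (st : Stats d) (β : ℝ) (θ : Fin d → ℝ) : Prop :=
  ∀ u, |(st.θ - θ) ⬝ᵥ u| ≤ β * weightedNorm st.Λ⁻¹ u

theorem abs_dotProduct_psi_sub_le (hI : I.Valid) {st : Stats d} {θ : Fin d → ℝ}
    (hst : st.Confident I.β θ) {s : S} {a : A} {p : PMF S}
    (hθ : ∀ s', (p s').toReal = θ ⬝ᵥ I.φ s' s a) {V : S → ℝ}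
    (hV : ∀ s, V s ∈ Set.Icc 0 (H : ℝ)) {x : ℝ} (hx : x ∈ net H I.ε) :
    |1 / I.α * (st.θ ⬝ᵥ psi I.φ (shortfall x V) s a) - 1 / I.α * expectedShortfall p V x| ≤
      bonus I st.Λ V s a := by
  have hx' := mem_net hI.ε_pos hx
  rw [expectedShortfall, ← dotProduct_psi hI.normalized
    (shortfall_mem_Icc hx'.1 hx'.2 fun s => (hV s).1) s a hθ, ← mul_sub, ← sub_dotProduct, abs_mul,
    abs_of_nonneg (one_div_nonneg.2 hI.α_mem.1.le)]
  have h1 := hst (psi I.φ (shortfall x V) s a)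
  have h2 := mul_le_mul_of_nonneg_left (Finset.le_sup' (featureNorm I st.Λ V s a) hx) hI.β_nonneg
  refine (mul_le_mul_of_nonneg_left (h1.trans h2) (one_div_nonneg.2 hI.α_mem.1.le)).trans_eq ?_
  rw [bonus]
  ring

theorem cvar_le_cvarNet_add (hI : I.Valid) {st : Stats d} {θ : Fin d → ℝ}
    (hst : st.Confident I.β θ) {s : S} {a : A} {p : PMF S}
    (hθ : ∀ s', (p s').toReal = θ ⬝ᵥ I.φ s' s a) {V : S → ℝ}
    (hV : ∀ s, V s ∈ Set.Icc 0 (H : ℝ)) :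
    cvar I.α p V ≤ cvarNet I st.θ V s a + bonus I st.Λ V s a + I.ε := by
  refine exists_mem_net_cvar_le p hI.α_mem hI.ε_pos hV fun x hx => ?_
  have h1 := abs_le.1 (abs_dotProduct_psi_sub_le hI hst hθ hV hx)
  have h2 := Finset.le_sup' (fun x => x - 1 / I.α * (st.θ ⬝ᵥ psi I.φ (shortfall x V) s a)) hx
  rw [cvarNet]
  linarith [h1.2]

theorem cvarNet_le_cvar_add (hI : I.Valid) {st : Stats d} {θ : Fin d → ℝ}
    (hst : st.Confident I.β θ) {s : S} {a : A} {p : PMF S}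
    (hθ : ∀ s', (p s').toReal = θ ⬝ᵥ I.φ s' s a) {V : S → ℝ}
    (hV : ∀ s, V s ∈ Set.Icc 0 (H : ℝ)) :
    cvarNet I st.θ V s a ≤ cvar I.α p V + bonus I st.Λ V s a := by
  refine Finset.sup'_le _ _ fun x hx => ?_
  have h1 := abs_le.1 (abs_dotProduct_psi_sub_le hI hst hθ hV hx)
  have h2 := le_cvar p hI.α_mem (Nat.cast_nonneg H) hV x
  linarith [h1.1]

variable [Fintype A] [Nonempty A] (M : EpisodicMDP S A H) {θ : Fin H → Fin d → ℝ}

/-- Optimism: the optimistic value functions dominate the values of all policies. -/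
theorem policyValue_le_optimisticV (hI : I.Valid) (hr : I.r = M.r) {st : Fin H → Stats d}
    (hst : ∀ h, (st h).Confident I.β (θ h))
    (hθ : ∀ h s' s a, (M.P h s a s').toReal = θ h ⬝ᵥ I.φ s' s a) (π : Policy S A H)
    (i : Fin (H + 1)) (s : S) : policyValue I.α M π i s ≤ optimisticV I st i s := by
  induction i using Fin.reverseInduction generalizing s with
  | last => rw [policyValue_last, optimisticV_last]
  | cast h ih =>
    rw [optimisticV_castSucc]
    refine le_min ?_ (policyValue_mem_Icc_horizon hI.α_mem M π _ s).2
    refine le_trans ?_ (Finset.le_sup' _ (Finset.mem_univ (π h s)))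
    have h1 := cvar_mono (M.P h s (π h s)) hI.α_mem (Nat.cast_nonneg H)
      (optimisticV_mem_Icc hI st h.succ) (policyValue_mem_Icc_horizon hI.α_mem M π h.succ) ih
    have h2 := cvar_le_cvarNet_add hI (hst h) (fun s' => hθ h s' s (π h s))
      (optimisticV_mem_Icc hI st h.succ)
    have h3 := hI.ε_pos
    rw [policyValue_castSucc, optimisticQ, hr]
    linarith

variable (T : TieBreak S A H I.ε)

/-- One step of the comparison of the optimistic values with the values of the policy played. -/
theorem optimisticV_sub_policyValue_le (hI : I.Valid) (hr : I.r = M.r) {hist : History S H}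
    (hst : ∀ h, (stats I T hist h).Confident I.β (θ h))
    (hθ : ∀ h s' s a, (M.P h s a s').toReal = θ h ⬝ᵥ I.φ s' s a) {c : ℝ} (hc : 0 < c)
    (i : Fin (H + 1)) (s : S) :
    optimisticV I (stats I T hist) i s ≤ policyValue I.α M (icvarL I T hist) i s +
      ((H : ℝ) - (i : ℕ)) * (c + 2 * I.ε) + ((2 * I.β / I.α) ^ 2 / (4 * c)) *
        (I.α ^ ((i : ℕ) + 1) / I.α ^ H) * widthValue T M hist i s := by
  have hα := hI.α_mem
  induction i using Fin.reverseInduction generalizing s with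
  | last => simp [optimisticV_last, policyValue_last, widthValue_last]
  | cast h ih =>
    set a := icvarL I T hist h s with ha
    set κ := (2 * I.β / I.α) ^ 2 / (4 * c) with hκ
    have hκ0 : 0 ≤ κ := by positivity
    set V := optimisticV I (stats I T hist) h.succ with hV
    have hα0 := hα.1
    have h1 : optimisticV I (stats I T hist) h.castSucc s ≤
        optimisticQ I (stats I T hist h) h V s a := by
      rw [optimisticV_castSucc]
      exact (min_le_left _ _).trans (Finset.sup'_le _ _ fun b _ => T.act_max hist h s _ b)
    have h2 := cvarNet_le_cvar_add hI (hst h) (fun s' => hθ h s' s a)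
      (optimisticV_mem_Icc hI (stats I T hist) h.succ)
    have hbonus : bonus I (stats I T hist h).Λ V s a = I.β / I.α * width I T hist h s := rfl
    have hW := widthValue_mem_Icc T M hI hist h.succ
    have hfac : 0 ≤ κ * (I.α ^ ((h.succ : ℕ) + 1) / I.α ^ H) := by positivity
    -- The constant part of the induction hypothesis plays the role of `z`, and the multiple of
    -- `widthValue` that of `G`.
    have h3 := cvar_le_cvar_add (M.P h s a) hα (Nat.cast_nonneg H)
      (policyValue_mem_Icc_horizon hα M (icvarL I T hist) h.succ)
      (optimisticV_mem_Icc hI (stats I T hist) h.succ)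
      (G := fun s' => κ * (I.α ^ ((h.succ : ℕ) + 1) / I.α ^ H) * widthValue T M hist h.succ s')
      (D := κ * (I.α ^ ((h.succ : ℕ) + 1) / I.α ^ H) * ((H : ℝ) - (h.succ : ℕ)))
      (fun s' => ⟨mul_nonneg hfac (hW s').1, mul_le_mul_of_nonneg_left (hW s').2 hfac⟩) ih
    have h4 : ∑' s', (M.P h s a s').toReal *
        (κ * (I.α ^ ((h.succ : ℕ) + 1) / I.α ^ H) * widthValue T M hist h.succ s') =
        κ * (I.α ^ ((h.succ : ℕ) + 1) / I.α ^ H) *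
          ∑' s', (M.P h s a s').toReal * widthValue T M hist h.succ s' := by
      rw [← tsum_mul_left]
      exact tsum_congr fun s' => by ring
    set E := ∑' s', (M.P h s a s').toReal * widthValue T M hist h.succ s' with hE
    -- The factor `1/α` of this step lowers the exponent of `α` by one, as going from `h + 1` back
    -- to `h` requires.
    have h5 : 1 / I.α * (κ * (I.α ^ ((h.succ : ℕ) + 1) / I.α ^ H) * E) =
        κ * (I.α ^ ((h.castSucc : ℕ) + 1) / I.α ^ H) * E := by
      simp only [Fin.val_succ, Fin.val_castSucc]
      rw [pow_succ I.α (h + 1)]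
      field_simp
    rw [h4, h5] at h3
    -- The width of the current step carries no power of `1/α` beyond `κ`; its weight is enlarged to
    -- that of the later steps so that one recursion covers both.
    have hpow : 1 ≤ I.α ^ ((h.castSucc : ℕ) + 1) / I.α ^ H := by
      rw [one_le_div (by positivity)]
      exact pow_le_pow_of_le_one hα0.le hα.2 h.2
    -- AM–GM. The factor `2` counts the bonus once in the optimistic value and once as estimation
    -- error. Propagating the widths themselves would leave the powers of `1/α` outside the final
    -- square root.
    have h6 : 2 * (I.β / I.α * width I T hist h s) ≤ c + κ * width I T hist h s ^ 2 := by
      have h7 : κ * width I T hist h s ^ 2 =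
          (2 * (I.β / I.α * width I T hist h s)) ^ 2 / (4 * c) := by
        rw [hκ]
        ring
      rw [h7, ← sub_le_iff_le_add', le_div_iff₀ (by positivity)]
      nlinarith [sq_nonneg (2 * (I.β / I.α * width I T hist h s) - 2 * c)]
    have h8 : κ * width I T hist h s ^ 2 ≤
        κ * (I.α ^ ((h.castSucc : ℕ) + 1) / I.α ^ H) * width I T hist h s ^ 2 :=
      mul_le_mul_of_nonneg_right (le_mul_of_one_le_right hκ0 hpow) (sq_nonneg _)
    rw [optimisticQ, hbonus, hr] at h1
    rw [hbonus] at h2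
    rw [policyValue_castSucc, widthValue_castSucc, mul_add (κ * _), ← ha, ← hE]
    simp only [Fin.val_succ, Fin.val_castSucc] at *
    push_cast at *
    linarith

/-- The regret, given that the parameters lie in the confidence ellipsoids of all episodes. -/
theorem regret_le (hI : I.Valid) (hr : I.r = M.r)
    (hθ : ∀ h s' s a, (M.P h s a s').toReal = θ h ⬝ᵥ I.φ s' s a) {c : ℝ} (hc : 0 < c)
    (hist : History S H)
    (hst : ∀ l, l <:+ hist → ∀ h, (stats I T l h).Confident I.β (θ h)) :
    regret I.α M (icvarL I T) hist ≤ hist.length * (H * (c + 2 * I.ε)) +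
      (2 * I.β / I.α) ^ 2 / (4 * c) * (I.α / I.α ^ H) * totalWidthValue T M hist := by
  induction hist with
  | nil => simp [regret, totalWidthValue]
  | cons ep hist ih =>
    have h1 := ih fun l hl => hst l (hl.trans (List.suffix_cons ep hist))
    have hst' := hst hist (List.suffix_cons ep hist)
    have h2 : optimalValue I.α M 0 (ep 0) ≤ optimisticV I (stats I T hist) 0 (ep 0) := by
      have : Nonempty (Policy S A H) := ⟨icvarL I T hist⟩
      exact ciSup_le fun π => policyValue_le_optimisticV M hI hr hst' hθ π 0 (ep 0)
    have h3 := optimisticV_sub_policyValue_le M T hI hr hst' hθ hc 0 (ep 0)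
    rw [regret, totalWidthValue, List.length_cons]
    simp only [Fin.val_zero, Nat.cast_zero, sub_zero, zero_add, pow_one] at h3
    push_cast
    linarith

end Regret

/-! ### The confidence radius against the bonus multiplier. -/

section Radius

theorem sqrt_le_half_sqrt_mul_add_one {x L : ℝ} (h0 : 0 ≤ x) (hx1 : 1 ≤ x) (hx : x ≤ 5)
    (hL : 4 / 3 ≤ L) : √x ≤ 1 / 2 * √(x * L) + 1 := by
  have h1 : √(x * (4 / 3)) ≤ √(x * L) := Real.sqrt_le_sqrt (by nlinarith)
  have h2 : 2 * (√x - 1) ≤ √(x * (4 / 3)) := by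
    refine Real.le_sqrt_of_sq_le ?_
    have h3 := Real.sq_sqrt h0
    have h4 : 2 * x / 3 + 1 ≤ 2 * √x := by
      refine abs_le_of_sq_le_sq' ?_ (by positivity) |>.2
      nlinarith
    nlinarith
  linarith

theorem log_ratio_add_ge {K : ℕ} (hK : 1 ≤ K) {l : ℝ} (hl : Real.log 2 ≤ l)
    (h : 4 < (K : ℝ) + 2 * l) :
    Real.log (1 + (K : ℝ) / 6) + l / 3 ≤ Real.log (1 + K) + l - 4 / 3 := by
  have hpos : (0 : ℝ) < 1 + (K : ℝ) / 6 := by positivity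
  have key : ∀ r : ℝ, 0 < r → r * (1 + (K : ℝ) / 6) ≤ 1 + K →
      Real.log r + Real.log (1 + (K : ℝ) / 6) ≤ Real.log (1 + K) := by
    intro r hr h
    rw [← Real.log_mul hr.ne' hpos.ne']
    exact Real.log_le_log (by positivity) h
  obtain rfl | rfl | hK3 : K = 1 ∨ K = 2 ∨ 3 ≤ K := by omega
  -- For `K = 1, 2` the hypothesis `h` forces `l > 3/2`, respectively `l > 1`, and the exact ratios
  -- `12/7` and `9/4` suffice.
  · have h1 := key (12 / 7) (by norm_num) (by norm_num)
    have h2 := Real.one_sub_inv_le_log_of_pos (show (0 : ℝ) < 12 / 7 by norm_num)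
    norm_num at h h1 h2 ⊢
    linarith
  · have h1 := key ((3 / 2) ^ 2) (by norm_num) (by norm_num)
    have h2 := Real.one_sub_inv_le_log_of_pos (show (0 : ℝ) < 3 / 2 by norm_num)
    rw [Real.log_pow] at h1
    norm_num at h h1 h2 ⊢
    linarith
  · have hK3' : (3 : ℝ) ≤ K := by exact_mod_cast hK3
    -- The ratio `(1 + K)/(1 + K/6)` increases with `K` and equals `8/3` at `K = 3`; here `l ≥ log
    -- 2` is enough.
    have h1 := key (8 / 3) (by norm_num) (by linarith)
    have h2 : (4 : ℝ) ≤ 3 * Real.log (8 / 3) + 2 * Real.log 2 := by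
      have h3 : 3 * Real.log (8 / 3) + 2 * Real.log 2 = Real.log ((8 / 3) ^ 3 * 2 ^ 2) := by
        rw [Real.log_mul (by norm_num) (by norm_num), Real.log_pow, Real.log_pow]
        norm_num
      rw [h3, Real.le_log_iff_exp_le (by norm_num)]
      have h4 : Real.exp 4 = Real.exp 1 ^ 4 := by
        rw [← Real.exp_nat_mul]
        norm_num
      rw [h4]
      have h5 := Real.exp_one_lt_d9
      refine (pow_le_pow_left₀ (Real.exp_pos 1).le h5.le 4).trans ?_
      norm_num
    linarith

theorem nat_mul_log_one_add_div_le {d : ℕ} (hd : 1 ≤ d) {x : ℝ} (hx : 0 ≤ x) :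
    d * Real.log (1 + x / d) ≤ x := by
  have hd' : (0 : ℝ) < d := by exact_mod_cast hd
  have h := Real.log_le_sub_one_of_pos (show 0 < 1 + x / d by positivity)
  have h2 : (d : ℝ) * (x / d) = x := mul_div_cancel₀ _ hd'.ne'
  nlinarith

/-- The numerical comparison of the self-normalized bound with the bonus multiplier. -/
theorem half_sqrt_add_sqrt_le {d K : ℕ} (hd : 1 ≤ d) (hK : 1 ≤ K) {l L : ℝ}
    (hl : Real.log 2 ≤ l) (hL : Real.log (1 + K) + l ≤ L) :
    1 / 2 * √(d * Real.log (1 + (K : ℝ) / d) + 2 * l) + √(d : ℝ) ≤ √(d * L) + 1 := by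
  have hd1 : (1 : ℝ) ≤ d := by exact_mod_cast hd
  have hK1 : (1 : ℝ) ≤ K := by exact_mod_cast hK
  have hlog2 := Real.log_two_gt_d9
  have hlogK : Real.log 2 ≤ Real.log (1 + K) := Real.log_le_log (by norm_num) (by linarith)
  have hL1 : 4 / 3 ≤ L := by linarith
  have hmono : ∀ t : ℝ, 1 ≤ t → t ≤ d → Real.log (1 + (K : ℝ) / d) ≤ Real.log (1 + K / t) := by
    intro t ht htd
    refine Real.log_le_log (by positivity) ?_
    gcongr
  -- The left side contains `√d` where the right side has only `1`; the factor `1/2` has to pay for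
  -- it. For small `d` half of `√(dL)` covers `√d - 1`; for `d ≥ 6` the gain comes from `log(1 +
  -- K/d)` being well below `log(1 + K)`.
  rcases le_or_gt d 5 with h5 | h5
  · have h5' : (d : ℝ) ≤ 5 := by exact_mod_cast h5
    have h6 := sqrt_le_half_sqrt_mul_add_one (by linarith) hd1 h5' hL1
    rcases hd.eq_or_lt with rfl | hd2
    · have h7 : √((1 : ℕ) * Real.log (1 + (K : ℝ) / (1 : ℕ)) + 2 * l) ≤ √(4 * ((1 : ℕ) * L)) := by
        refine Real.sqrt_le_sqrt ?_
        simp only [Nat.cast_one, div_one, one_mul]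
        linarith
      rw [Real.sqrt_mul (by norm_num), show (4 : ℝ) = 2 ^ 2 by norm_num,
        Real.sqrt_sq (by norm_num)] at h7
      rw [Nat.cast_one, Real.sqrt_one]
      rw [Nat.cast_one] at h7
      linarith
    · have hd2' : (2 : ℝ) ≤ d := by exact_mod_cast hd2
      have h7 : √(d * Real.log (1 + (K : ℝ) / d) + 2 * l) ≤ √(d * L) := by
        refine Real.sqrt_le_sqrt ?_
        have := hmono 1 le_rfl hd1
        rw [div_one] at this
        nlinarith
      linarith
  · have h6 : (6 : ℝ) ≤ d := by exact_mod_cast h5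
    rcases le_or_gt ((K : ℝ) + 2 * l) 4 with h | h
    · have h1 := nat_mul_log_one_add_div_le hd (Nat.cast_nonneg (α := ℝ) K)
      have h2 : √(d * Real.log (1 + (K : ℝ) / d) + 2 * l) ≤ 2 := by
        rw [Real.sqrt_le_left (by norm_num)]
        linarith
      have h3 : √(d : ℝ) ≤ √(d * L) := Real.sqrt_le_sqrt (by nlinarith)
      linarith
    · have h1 := log_ratio_add_ge hK hl h
      have h2 := hmono 6 (by norm_num) h6
      have h3 : √(d * Real.log (1 + (K : ℝ) / d) + 2 * l) ≤ √(d * (L - 4 / 3)) := by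
        refine Real.sqrt_le_sqrt ?_
        nlinarith
      -- After squaring this is `(3√L - 4)² ≥ 0`, which is why the gain needed is `4/3`.
      have h4 : √(L - 4 / 3) ≤ 2 * (√L - 1) := by
        have h8 : 1 ≤ √L := Real.one_le_sqrt.2 (by linarith)
        rw [Real.sqrt_le_left (by linarith)]
        have h9 := Real.sq_sqrt (show 0 ≤ L by linarith)
        nlinarith [sq_nonneg (3 * √L - 4)]
      rw [Real.sqrt_mul (by linarith)] at h3 ⊢
      have h5 := mul_le_mul_of_nonneg_left h4 (Real.sqrt_nonneg (d : ℝ))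
      nlinarith

/-- The threshold `H / δ` of the union bound gives `2 log(H/δ)`, and `δ < 1/2` gives `log(H/δ) ≥ log
2`, which the numerical lemma requires. -/
theorem radius_le_betaHat {d H K n : ℕ} (hd : 1 ≤ d) (hH : 1 ≤ H) (hK : 1 ≤ K) (hn : n ≤ K)
    {δ : ℝ} (hδ : 0 < δ) (hδ2 : δ < 1 / 2) :
    (H : ℝ) / 2 * √(d * Real.log (1 + (n : ℝ) / d) + 2 * Real.log (H / δ)) + H * √(d : ℝ) ≤
      betaHat d H K δ ((H : ℝ) ^ 2) := by
  have hH1 : (1 : ℝ) ≤ H := by exact_mod_cast hH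
  have hK1 : (1 : ℝ) ≤ K := by exact_mod_cast hK
  have hnK : (n : ℝ) ≤ K := by exact_mod_cast hn
  have h1 : Real.log 2 ≤ Real.log (H / δ) := by
    refine Real.log_le_log (by norm_num) ?_
    rw [le_div_iff₀ hδ]
    linarith
  have h2 : Real.log (1 + K) + Real.log (H / δ) ≤
      Real.log (((H : ℝ) + K * (H : ℝ) ^ 3) / δ) := by
    rw [← Real.log_mul (by positivity) (by positivity)]
    refine Real.log_le_log (by positivity) ?_
    rw [← mul_div_assoc]
    refine div_le_div_of_nonneg_right ?_ hδ.le
    have h3 : (H : ℝ) ≤ (H : ℝ) ^ 3 := le_self_pow₀ hH1 (by norm_num)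
    nlinarith
  have h3 := half_sqrt_add_sqrt_le hd hK h1 h2
  have h4 : √(d * Real.log (1 + (n : ℝ) / d) + 2 * Real.log (H / δ)) ≤
      √(d * Real.log (1 + (K : ℝ) / d) + 2 * Real.log (H / δ)) := by
    refine Real.sqrt_le_sqrt ?_
    gcongr
  rw [betaHat, Real.sqrt_sq (by linarith)]
  nlinarith

end Radius

/-! ### Numerical form and order of the regret bound. -/

section Bounds

/-- The factor of the regret bound that comes from the widths. -/
noncomputable def widthBound (d H K : ℕ) (δ : ℝ) : ℝ :=
  8 * d * H * Real.log K + 4 * (H : ℝ) ^ 3 * Real.log ((4 * Real.logb 2 K + 8) / δ)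

theorem logb_two_nonneg {K : ℕ} (hK : 1 ≤ K) : 0 ≤ Real.logb 2 K :=
  Real.logb_nonneg (by norm_num) (by exact_mod_cast hK)

theorem log_eight_add_log_le {K : ℕ} (hK : 1 ≤ K) {δ : ℝ} (hδ : 0 < δ) :
    Real.log 8 + Real.log (1 / δ) ≤ Real.log ((4 * Real.logb 2 K + 8) / δ) := by
  rw [← Real.log_mul (by norm_num) (by positivity)]
  refine Real.log_le_log (by positivity) ?_
  rw [mul_one_div]
  exact div_le_div_of_nonneg_right (by linarith [logb_two_nonneg hK]) hδ.le

theorem one_le_log_eight : 1 ≤ Real.log 8 := by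
  rw [Real.le_log_iff_exp_le (by norm_num)]
  linarith [Real.exp_one_lt_d9]

theorem width_terms_le {d H K : ℕ} (hd : 1 ≤ d) (hH : 1 ≤ H) (hK : 1 ≤ K) {δ : ℝ}
    (hδ : δ ∈ Set.Ioc (0 : ℝ) 1) :
    2 * (2 * (H * (d * Real.log (1 + (K : ℝ) / d)))) + 2 * H * Real.log (1 / δ) ≤
      widthBound d H K δ := by
  have hH1 : (1 : ℝ) ≤ H := by exact_mod_cast hH
  have hd1 : (1 : ℝ) ≤ d := by exact_mod_cast hd
  have h1 := log_eight_add_log_le hK hδ.1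
  have h8 := one_le_log_eight
  have h2 : 0 ≤ Real.log (1 / δ) := Real.log_nonneg ((one_le_div hδ.1).2 hδ.2)
  have h3 : (H : ℝ) ≤ (H : ℝ) ^ 3 := le_self_pow₀ hH1 (by norm_num)
  have h4 : 4 * (H : ℝ) * (1 + Real.log (1 / δ)) ≤
      4 * (H : ℝ) ^ 3 * Real.log ((4 * Real.logb 2 K + 8) / δ) :=
    mul_le_mul (by linarith) (by linarith) (by linarith) (by positivity)
  have h5 : 0 ≤ (H : ℝ) * Real.log (1 / δ) := by positivity
  rw [widthBound]
  -- For `K = 1` the term with `log K` vanishes and `d log(1 + 1/d) ≤ 1` is absorbed by the `H³`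
  -- term. For `K ≥ 2` one has `1 + K/d ≤ K²`, which produces the constant `8`.
  rcases hK.eq_or_lt with rfl | hK2
  · have h6 := nat_mul_log_one_add_div_le hd (Nat.cast_nonneg (α := ℝ) 1)
    simp only [Nat.cast_one] at *
    rw [Real.log_one]
    nlinarith
  · have hK2' : (2 : ℝ) ≤ K := by exact_mod_cast hK2
    have h6 : Real.log (1 + (K : ℝ) / d) ≤ 2 * Real.log K := by
      have : 2 * Real.log (K : ℝ) = Real.log ((K : ℝ) ^ 2) := by
        rw [Real.log_pow]
        norm_num
      rw [this]
      refine Real.log_le_log (by positivity) ?_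
      have h7 : (K : ℝ) / d ≤ K := div_le_self (by linarith) hd1
      nlinarith
    have h7 := mul_le_mul_of_nonneg_left h6 (show 0 ≤ (H : ℝ) * d by positivity)
    nlinarith

theorem widthBound_pos {d H K : ℕ} (hH : 1 ≤ H) (hK : 1 ≤ K) {δ : ℝ}
    (hδ : δ ∈ Set.Ioc (0 : ℝ) 1) : 0 < widthBound d H K δ := by
  have hH1 : (1 : ℝ) ≤ H := by exact_mod_cast hH
  have h1 := log_eight_add_log_le hK hδ.1
  have h8 := one_le_log_eight
  have h2 : 0 ≤ Real.log (1 / δ) := Real.log_nonneg ((one_le_div hδ.1).2 hδ.2)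
  have h3 : 0 ≤ Real.log (K : ℝ) := Real.log_natCast_nonneg K
  have h4 : 0 < Real.log ((4 * Real.logb 2 K + 8) / δ) := by linarith
  rw [widthBound]
  positivity

/-- The two powers of `α` multiply to `α^{2(H-1)} ≤ 1`. The exponent `H - 3` may be negative, hence
the integer power. -/
theorem discretization_le {d H K : ℕ} (hH : 1 ≤ H) (hK : 1 ≤ K) {α : ℝ}
    (hα : α ∈ Set.Ioc (0 : ℝ) 1) :
    K * (H * (2 * (d * H * √(α ^ ((H : ℤ) - 3) / K)))) ≤
      4 * d * (H : ℝ) ^ 2 * √(K : ℝ) / √(α ^ (H + 1)) := by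
  have hα0 := hα.1
  have hK0 : (0 : ℝ) < K := by exact_mod_cast hK
  have h1 : α ^ ((H : ℤ) - 3) * α ^ (H + 1) = α ^ (2 * (H - 1)) := by
    rw [← zpow_natCast α (H + 1), ← zpow_natCast α (2 * (H - 1)), ← zpow_add₀ hα0.ne']
    congr 1
    push_cast [Nat.cast_sub hH]
    ring
  have h2 : √(α ^ ((H : ℤ) - 3)) * √(α ^ (H + 1)) ≤ 1 := by
    rw [← Real.sqrt_mul (by positivity), h1, Real.sqrt_le_one]
    exact pow_le_one₀ hα0.le hα.2
  rw [le_div_iff₀ (by positivity), Real.sqrt_div (by positivity)]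
  have h3 : (K : ℝ) * (H * (2 * (d * H * (√(α ^ ((H : ℤ) - 3)) / √(K : ℝ))))) * √(α ^ (H + 1)) =
      2 * d * (H : ℝ) ^ 2 * √(K : ℝ) * (√(α ^ ((H : ℤ) - 3)) * √(α ^ (H + 1))) := by
    have hs := Real.sq_sqrt hK0.le
    have hs0 := Real.sqrt_pos.2 hK0
    field_simp
    rw [hs]
    ring
  rw [h3]
  have h4 : 0 ≤ 2 * d * (H : ℝ) ^ 2 * √(K : ℝ) := by positivity
  nlinarith [mul_le_mul_of_nonneg_left h2 h4]

/-- Optimization of the free parameter of the regret decomposition. -/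
theorem exists_parameter {d H K : ℕ} (hH : 1 ≤ H) (hK : 1 ≤ K) {α δ β : ℝ}
    (hα : α ∈ Set.Ioc (0 : ℝ) 1) (hδ : δ ∈ Set.Ioc (0 : ℝ) 1) (hβ : 0 < β) :
    ∃ c : ℝ, 0 < c ∧ K * (H * c) +
      (2 * β / α) ^ 2 / (4 * c) * (α / α ^ H) * widthBound d H K δ =
      2 * β * √((K : ℝ) * H / α ^ (H + 1)) * √(widthBound d H K δ) := by
  have hW := widthBound_pos (d := d) hH hK hδ
  have hα0 := hα.1
  have hH0 : (0 : ℝ) < H := by exact_mod_cast hH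
  have hK0 : (0 : ℝ) < K := by exact_mod_cast hK
  set w := widthBound d H K δ
  have hs := Real.sq_sqrt (show 0 ≤ (K : ℝ) * H / α ^ (H + 1) by positivity)
  have hw := Real.sq_sqrt hW.le
  have hs0 : 0 < √((K : ℝ) * H / α ^ (H + 1)) := by positivity
  have hw0 : 0 < √w := by positivity
  set u := √((K : ℝ) * H / α ^ (H + 1))
  -- The minimizer over `c`, at which the two terms on the left are equal.
  refine ⟨β * u * √w / (K * H), by positivity, ?_⟩
  rw [eq_div_iff (by positivity)] at hs
  rw [← hw]
  field_simp
  rw [Real.sqrt_sq hw0.le]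
  field_simp
  linear_combination (-4 : ℝ) * hs

theorem betaHat_le {d H K : ℕ} (hd : 1 ≤ d) (hH : 1 ≤ H) (hK : 1 ≤ K) {δ : ℝ}
    (hδ : δ ∈ Set.Ioc (0 : ℝ) 1) :
    betaHat d H K δ ((H : ℝ) ^ 2) ≤ 3 * H * √(d * (1 + Real.log (K * H / δ))) := by
  have hd1 : (1 : ℝ) ≤ d := by exact_mod_cast hd
  have hH1 : (1 : ℝ) ≤ H := by exact_mod_cast hH
  have hK1 : (1 : ℝ) ≤ K := by exact_mod_cast hK
  have hδ0 := hδ.1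
  have hx : 1 ≤ K * H / δ := by
    rw [one_le_div hδ0]
    nlinarith [hδ.2]
  have hl := Real.log_nonneg hx
  have h1 : Real.log (((H : ℝ) + K * (H : ℝ) ^ 3) / δ) ≤ 3 * (1 + Real.log (K * H / δ)) := by
    have h2 : ((H : ℝ) + K * (H : ℝ) ^ 3) / δ ≤ 2 * (K * H / δ) ^ 3 := by
      rw [div_pow, ← mul_div_assoc]
      refine div_le_div₀ (by positivity) ?_ (by positivity)
        (pow_le_of_le_one hδ0.le hδ.2 (by norm_num))
      have h3 : (H : ℝ) ≤ (H : ℝ) ^ 3 := le_self_pow₀ hH1 (by norm_num)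
      have h4 : (K : ℝ) ≤ (K : ℝ) ^ 3 := le_self_pow₀ hK1 (by norm_num)
      have h5 : (H : ℝ) ^ 3 ≤ K * (H : ℝ) ^ 3 := le_mul_of_one_le_left (by positivity) hK1
      have h6 : K * (H : ℝ) ^ 3 ≤ (K : ℝ) ^ 3 * (H : ℝ) ^ 3 :=
        mul_le_mul_of_nonneg_right h4 (by positivity)
      rw [mul_pow]
      linarith
    refine (Real.log_le_log (by positivity) h2).trans ?_
    rw [Real.log_mul (by norm_num) (by positivity), Real.log_pow]
    have := Real.log_two_lt_d9
    push_cast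
    linarith
  have h3 : √(d * Real.log (((H : ℝ) + K * (H : ℝ) ^ 3) / δ)) ≤
      2 * √(d * (1 + Real.log (K * H / δ))) := by
    rw [show (2 : ℝ) = √(2 ^ 2) by rw [Real.sqrt_sq (by norm_num)], ← Real.sqrt_mul (by norm_num)]
    refine Real.sqrt_le_sqrt ?_
    nlinarith
  have h4 : 1 ≤ √(d * (1 + Real.log (K * H / δ))) := Real.one_le_sqrt.2 (by nlinarith)
  rw [betaHat, Real.sqrt_sq (by linarith)]
  nlinarith

theorem widthBound_le {d H K : ℕ} (hH : 1 ≤ H) (hK : 1 ≤ K) {δ : ℝ}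
    (hδ : δ ∈ Set.Ioc (0 : ℝ) 1) :
    widthBound d H K δ ≤ 12 * (d * H + (H : ℝ) ^ 3) * (1 + Real.log (K * H / δ)) := by
  have hH1 : (1 : ℝ) ≤ H := by exact_mod_cast hH
  have hK1 : (1 : ℝ) ≤ K := by exact_mod_cast hK
  have hδ0 := hδ.1
  have hK2 : (K : ℝ) / δ ≤ K * H / δ :=
    div_le_div_of_nonneg_right (le_mul_of_one_le_right (by linarith) hH1) hδ0.le
  have h1 : Real.log K ≤ Real.log (K * H / δ) := by
    refine Real.log_le_log (by linarith) (le_trans ?_ hK2)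
    rw [le_div_iff₀ hδ0]
    nlinarith [hδ.2]
  have h0 := Real.log_natCast_nonneg K
  have h2 : Real.log ((4 * Real.logb 2 K + 8) / δ) ≤ 3 * (1 + Real.log (K * H / δ)) := by
    have h3 : Real.logb 2 K ≤ K := by
      rw [Real.logb_le_iff_le_rpow (by norm_num) (by linarith), Real.rpow_natCast]
      exact_mod_cast Nat.lt_two_pow_self.le
    have h4 : (4 * Real.logb 2 K + 8) / δ ≤ 12 * (K * H / δ) := by
      refine le_trans ?_ (mul_le_mul_of_nonneg_left hK2 (by norm_num))
      rw [← mul_div_assoc]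
      exact div_le_div_of_nonneg_right (by linarith) hδ0.le
    have h5 := logb_two_nonneg hK
    refine (Real.log_le_log (by positivity) h4).trans ?_
    rw [Real.log_mul (by norm_num) (by positivity)]
    have h6 : Real.log 12 ≤ 3 := by
      rw [Real.log_le_iff_le_exp (by norm_num), show (3 : ℝ) = (3 : ℕ) * 1 by norm_num,
        Real.exp_nat_mul]
      have h7 := pow_le_pow_left₀ (by norm_num) Real.exp_one_gt_d9.le 3
      refine le_trans ?_ h7
      norm_num
    linarith
  have h8 : 8 * d * H * Real.log K ≤ 12 * (d * H) * (1 + Real.log (K * H / δ)) := by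
    have : 0 ≤ (d : ℝ) * H := by positivity
    nlinarith
  have h9 := mul_le_mul_of_nonneg_left h2 (show 0 ≤ 4 * (H : ℝ) ^ 3 by positivity)
  rw [widthBound]
  linarith

theorem regretBound_le {d H K : ℕ} (hd : 1 ≤ d) (hH : 1 ≤ H) (hK : 1 ≤ K) {α δ : ℝ}
    (hα : α ∈ Set.Ioc (0 : ℝ) 1) (hδ : δ ∈ Set.Ioc (0 : ℝ) 1) :
    regretBound d H K α δ (betaHat d H K δ ((H : ℝ) ^ 2)) ≤
      28 * (1 + Real.log (K * H / δ)) *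
        √(((d : ℝ) ^ 2 * (H : ℝ) ^ 4 + d * (H : ℝ) ^ 6) * K / α ^ (H + 1)) := by
  have hH1 : (1 : ℝ) ≤ H := by exact_mod_cast hH
  have hK1 : (1 : ℝ) ≤ K := by exact_mod_cast hK
  have hα0 := hα.1
  have hβ0 : 0 ≤ betaHat d H K δ ((H : ℝ) ^ 2) := by
    rw [betaHat]
    positivity
  have hβ := betaHat_le hd hH hK hδ
  have hw0 := widthBound_pos (d := d) hH hK hδ
  have hw := widthBound_le (d := d) hH hK hδ
  have hl : 0 ≤ Real.log (K * H / δ) := by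
    refine Real.log_nonneg ?_
    rw [one_le_div hδ.1]
    nlinarith [hδ.2]
  rw [show regretBound d H K α δ (betaHat d H K δ ((H : ℝ) ^ 2)) =
    4 * d * (H : ℝ) ^ 2 * √(K : ℝ) / √(α ^ (H + 1)) + 2 * betaHat d H K δ ((H : ℝ) ^ 2) *
      √((K : ℝ) * H / α ^ (H + 1)) * √(widthBound d H K δ) from rfl]
  set β := betaHat d H K δ ((H : ℝ) ^ 2)
  set w := widthBound d H K δ
  set l := 1 + Real.log (K * H / δ) with hl_def
  set Y := ((d : ℝ) ^ 2 * (H : ℝ) ^ 4 + d * (H : ℝ) ^ 6) * K / α ^ (H + 1) with hY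
  have hl1 : 1 ≤ l := by linarith
  have hY0 : 0 ≤ Y := by positivity
  have h1 : 4 * d * (H : ℝ) ^ 2 * √(K : ℝ) / √(α ^ (H + 1)) ≤ 4 * l * √Y := by
    have h2 : 4 * d * (H : ℝ) ^ 2 * √(K : ℝ) / √(α ^ (H + 1)) =
        4 * √((d : ℝ) ^ 2 * (H : ℝ) ^ 4 * K / α ^ (H + 1)) := by
      rw [Real.sqrt_div (by positivity), Real.sqrt_mul (by positivity),
        show (d : ℝ) ^ 2 * (H : ℝ) ^ 4 = (d * (H : ℝ) ^ 2) ^ 2 by ring,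
        Real.sqrt_sq (by positivity)]
      ring
    have h3 : √((d : ℝ) ^ 2 * (H : ℝ) ^ 4 * K / α ^ (H + 1)) ≤ √Y := by
      refine Real.sqrt_le_sqrt ?_
      rw [hY]
      gcongr
      exact le_add_of_nonneg_right (by positivity)
    rw [h2]
    nlinarith [Real.sqrt_nonneg Y]
  have h4 : 2 * β * √((K : ℝ) * H / α ^ (H + 1)) * √w ≤ 24 * l * √Y := by
    -- Squared, the constants are `4 · 9 · 12 = 432 ≤ 24²`; with the `4` of the discretization term
    -- this gives `28`.
    refine abs_le_of_sq_le_sq' ?_ (by positivity) |>.2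
    have h5 : β ^ 2 ≤ 9 * (H : ℝ) ^ 2 * (d * l) := by
      have := pow_le_pow_left₀ hβ0 hβ 2
      rwa [mul_pow, Real.sq_sqrt (by positivity), mul_pow, show (3 : ℝ) ^ 2 = 9 by norm_num] at this
    have h6 : β ^ 2 * w ≤ 9 * (H : ℝ) ^ 2 * (d * l) * (12 * (d * H + (H : ℝ) ^ 3) * l) :=
      mul_le_mul h5 hw hw0.le (by positivity)
    rw [mul_pow, mul_pow, mul_pow, mul_pow, mul_pow, Real.sq_sqrt (by positivity),
      Real.sq_sqrt hw0.le, Real.sq_sqrt hY0]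
    have h7 := mul_le_mul_of_nonneg_left h6
      (show 0 ≤ 4 * ((K : ℝ) * H / α ^ (H + 1)) by positivity)
    have h8 : 4 * ((K : ℝ) * H / α ^ (H + 1)) *
        (9 * (H : ℝ) ^ 2 * (d * l) * (12 * (d * H + (H : ℝ) ^ 3) * l)) = 432 * l ^ 2 * Y := by
      rw [hY]
      ring
    have h9 : 0 ≤ l ^ 2 * Y := by positivity
    linarith
  linarith

end Bounds

/-- In dimension `0` all transition probabilities would vanish, yet they sum to `1`. -/
theorem IsLinearMixture.dim_pos {S A : Type*} [Nonempty A] {H d : ℕ}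
    {M : EpisodicMDP S A H} {φ : S → S → A → Fin d → ℝ}
    (hM : IsLinearMixture M φ) (hH : 0 < H) (s : S) : 0 < d := by
  rcases Nat.eq_zero_or_pos d with rfl | h
  · obtain ⟨a⟩ := ‹Nonempty A›
    obtain ⟨θ, -, hθ⟩ := hM ⟨0, hH⟩
    have h1 := tsum_toReal (M.P ⟨0, hH⟩ s a)
    simp [hθ] at h1
  · exact h

/-! ### The exceptional event and the assembly. -/

section HighProbability

variable {S A : Type*} [Fintype A] [Nonempty A] {H d : ℕ} {I : Input S A H d}

theorem toOuterMeasure_le_of_mul_le {α : Type*} (p : PMF α) (s : Set α) {c : ℝ} (hc : 0 < c)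
    (h : ENNReal.ofReal c * p.toOuterMeasure s ≤ 1) :
    p.toOuterMeasure s ≤ ENNReal.ofReal (1 / c) := by
  rw [one_div, ENNReal.ofReal_inv_of_pos hc, ← one_mul (ENNReal.ofReal c)⁻¹, ← div_eq_mul_inv,
    ENNReal.le_div_iff_mul_le (Or.inl (by simpa using hc)) (Or.inl ENNReal.ofReal_ne_top), mul_comm]
  exact h

/-- The exceptional histories: some prefix leaves a confidence ellipsoid, or has expected widths
that are large in comparison with the realized ones. -/
def exceptional (T : TieBreak S A H I.ε) (M : EpisodicMDP S A H) (θ : Fin H → Fin d → ℝ) (δ : ℝ) :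
    Set (History S H) :=
  (⋃ h, {hist | ∃ l, l <:+ hist ∧ ENNReal.ofReal (H / δ) ≤ selfNormalized T (θ h) h l}) ∪
    {hist | ∃ l, l <:+ hist ∧ ENNReal.ofReal (1 / δ) ≤ widthProcess T M l}

theorem toOuterMeasure_exceptional_le (hI : I.Valid) (T : TieBreak S A H I.ε)
    (M : EpisodicMDP S A H) (env : History S H → PMF S) {θ : Fin H → Fin d → ℝ}
    (hθ : ∀ h s' s a, (M.P h s a s').toReal = θ h ⬝ᵥ I.φ s' s a) {δ : ℝ} (hδ : 0 < δ) (K : ℕ) :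
    (runLaw M env (icvarL I T) K).toOuterMeasure (exceptional T M θ δ) ≤
      ENNReal.ofReal (2 * δ) := by
  have hH : (0 : ℝ) < H := by exact_mod_cast hI.horizon_pos
  set p := runLaw M env (icvarL I T) K
  have h1 : ∀ h, p.toOuterMeasure
      {hist | ∃ l, l <:+ hist ∧ ENNReal.ofReal (H / δ) ≤ selfNormalized T (θ h) h l} ≤
      ENNReal.ofReal (δ / H) := fun h => by
    have := toOuterMeasure_le_of_mul_le p _ (div_pos hH hδ)
      ((toOuterMeasure_exists_suffix_le M env (icvarL I T) _ _
        (expect_selfNormalized_le T M hI (θ h) h (hθ h)) K).trans_eq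
          (selfNormalized_nil T hI (θ h) h))
    rwa [one_div_div] at this
  have h2 := toOuterMeasure_le_of_mul_le p _ (one_div_pos.2 hδ)
    ((toOuterMeasure_exists_suffix_le M env (icvarL I T) _ (ENNReal.ofReal (1 / δ))
      (expect_widthProcess_le T M hI) K).trans_eq
        (by simp [widthProcess, totalWidth, totalWidthValue]))
  rw [one_div_one_div] at h2
  -- The `H` regressions share one `δ`; the other `δ` goes to the widths.
  have h3 : ∑ _h : Fin H, ENNReal.ofReal (δ / H) = ENNReal.ofReal δ := by
    rw [Finset.sum_const, Finset.card_univ, Fintype.card_fin, nsmul_eq_mul,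
      ← ENNReal.ofReal_natCast, ← ENNReal.ofReal_mul (Nat.cast_nonneg H), mul_div_cancel₀ _ hH.ne']
  rw [two_mul, ENNReal.ofReal_add hδ.le hδ.le]
  refine (MeasureTheory.measure_union_le _ _).trans (add_le_add ?_ h2)
  refine (MeasureTheory.measure_iUnion_fintype_le _ _).trans ?_
  exact (Finset.sum_le_sum fun h _ => h1 h).trans_eq h3

/-- The regret bound outside of the exceptional histories. -/
theorem regret_le_regretBound (hI : I.Valid) (T : TieBreak S A H I.ε) (M : EpisodicMDP S A H)
    (hr : I.r = M.r) {θ : Fin H → Fin d → ℝ} (hnorm : ∀ h, ‖WithLp.toLp 2 (θ h)‖ ≤ √(d : ℝ))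
    (hθ : ∀ h s' s a, (M.P h s a s').toReal = θ h ⬝ᵥ I.φ s' s a) (hd : 1 ≤ d) {K : ℕ}
    (hK : 1 ≤ K) {δ : ℝ} (hδ : 0 < δ) (hδ2 : δ < 1 / 2)
    (hε : I.ε = d * H * √(I.α ^ ((H : ℤ) - 3) / K))
    (hβ : I.β = betaHat d H K δ ((H : ℝ) ^ 2)) {hist : History S H} (hlen : hist.length = K)
    (hgood : hist ∉ exceptional T M θ δ) :
    regret I.α M (icvarL I T) hist ≤ regretBound d H K I.α δ I.β := by
  have hH : 1 ≤ H := hI.horizon_pos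
  have hH0 : (0 : ℝ) < H := by exact_mod_cast hH
  have hδ' : δ ∈ Set.Ioc (0 : ℝ) 1 := ⟨hδ, by linarith⟩
  have hα0 := hI.α_mem.1
  simp only [exceptional, Set.mem_union, Set.mem_iUnion, not_or, not_exists] at hgood
  have hconf : ∀ l, l <:+ hist → ∀ h, (stats I T l h).Confident I.β (θ h) := by
    intro l hl h u
    refine (abs_sub_dotProduct_le T hI (hnorm h) h l u).trans
      (mul_le_mul_of_nonneg_right ?_ (weightedNorm_nonneg _ _))
    have h1 := weightedNorm_noise_le T hI (θ h) h (div_pos hH0 hδ)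
      (hist := l) fun hbad => hgood.1 h ⟨l, hl, hbad⟩
    have h2 := radius_le_betaHat hd hH hK (hl.length_le.trans_eq hlen) hδ hδ2
    have h3 := Real.sqrt_le_sqrt
      (add_le_add_left (logDetRatio_le T hI hd l h) (2 * Real.log (H / δ)))
    have h4 := mul_le_mul_of_nonneg_left h3 (show 0 ≤ (H : ℝ) / 2 by positivity)
    rw [hβ]
    linarith
  have hβ0 : 0 < I.β := by
    rw [hβ, betaHat, Real.sqrt_sq hH0.le]
    positivity
  obtain ⟨c, hc, hc_eq⟩ := exists_parameter (d := d) hH hK hI.α_mem hδ' hβ0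
  have h1 := regret_le M T hI hr hθ hc hist hconf
  have h2 : totalWidthValue T M hist ≤ widthBound d H K δ := by
    have h3 := totalWidthValue_le T M hI (one_div_pos.2 hδ) (hist := hist)
      fun hbad => hgood.2 ⟨hist, List.suffix_rfl, hbad⟩
    have h4 := totalWidth_le T hI hist
    have h5 : ∑ h, logDetRatio I T hist h ≤ H * (d * Real.log (1 + (K : ℝ) / d)) := by
      refine (Finset.sum_le_sum fun h _ => logDetRatio_le T hI hd hist h).trans_eq ?_
      rw [Finset.sum_const, Finset.card_univ, Fintype.card_fin, nsmul_eq_mul, hlen]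
    have h6 := width_terms_le hd hH hK hδ'
    linarith
  have h3 : (2 * I.β / I.α) ^ 2 / (4 * c) * (I.α / I.α ^ H) * totalWidthValue T M hist ≤
      (2 * I.β / I.α) ^ 2 / (4 * c) * (I.α / I.α ^ H) * widthBound d H K δ :=
    mul_le_mul_of_nonneg_left h2 (by positivity)
  have h4 := discretization_le (d := d) hH hK hI.α_mem
  rw [← hε] at h4
  rw [hlen] at h1
  rw [show regretBound d H K I.α δ I.β = 4 * d * (H : ℝ) ^ 2 * √(K : ℝ) / √(I.α ^ (H + 1)) +
    2 * I.β * √((K : ℝ) * H / I.α ^ (H + 1)) * √(widthBound d H K δ) from rfl]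
  linarith

theorem le_toOuterMeasure_regret_le (hI : I.Valid) (T : TieBreak S A H I.ε)
    (M : EpisodicMDP S A H) (env : History S H → PMF S) (hr : I.r = M.r)
    (hM : IsLinearMixture M I.φ) (hd : 1 ≤ d) {K : ℕ}
    (hK : 1 ≤ K) {δ : ℝ} (hδ : 0 < δ) (hδ2 : δ < 1 / 2)
    (hε : I.ε = d * H * √(I.α ^ ((H : ℤ) - 3) / K))
    (hβ : I.β = betaHat d H K δ ((H : ℝ) ^ 2)) :
    ENNReal.ofReal (1 - 2 * δ) ≤ (runLaw M env (icvarL I T) K).toOuterMeasure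
      {hist | regret I.α M (icvarL I T) hist ≤ regretBound d H K I.α δ I.β} := by
  choose θ hnorm hθ using hM
  set p := runLaw M env (icvarL I T) K
  set good := {hist | regret I.α M (icvarL I T) hist ≤ regretBound d H K I.α δ I.β}
  have h1 : p.toOuterMeasure (good ∪ exceptional T M θ δ) = 1 := by
    refine (p.toOuterMeasure_apply_eq_one_iff _).2 fun hist hist_mem => ?_
    by_cases hb : hist ∈ exceptional T M θ δ
    · exact Or.inr hb
    · exact Or.inl (regret_le_regretBound hI T M hr hnorm hθ hd hK hδ hδ2 hε hβ
        (length_of_mem_support_runLaw M env _ K hist_mem) hb)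
  have h2 := MeasureTheory.measure_union_le (μ := p.toOuterMeasure) good (exceptional T M θ δ)
  rw [h1] at h2
  rw [ENNReal.ofReal_sub _ (by positivity), ENNReal.ofReal_one]
  refine tsub_le_iff_right.2 (h2.trans (add_le_add_right ?_ _))
  exact toOuterMeasure_exceptional_le hI T M env hθ hδ K

end HighProbability

end ICVaR

theorem theorem1 :
    -- the regret bound, with probability at least `1 - 2δ`
    (∀ (S : Type*) (A : Type*) [Fintype A] [Nonempty A] (d H K : ℕ) (_ : 1 ≤ H) (_ : 1 ≤ K)
      (α δ lam ε β : ℝ) (_ : α ∈ Set.Ioc (0 : ℝ) 1) (_ : δ ∈ Set.Ioc (0 : ℝ) 1)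
      (_ : lam = (H : ℝ) ^ 2)
      (_ : ε = d * H * √(α ^ ((H : ℤ) - 3) / K))
      (_ : β = ICVaR.betaHat d H K δ lam)
      (M : ICVaR.EpisodicMDP S A H) (φ : S → S → A → Fin d → ℝ)
      (_ : ICVaR.IsNormalizedFeature φ) (_ : ICVaR.IsLinearMixture M φ)
      (env : ICVaR.History S H → PMF S) (T : ICVaR.TieBreak S A H ε)
      (alg : ICVaR.History S H → ICVaR.Policy S A H)
      (_ : alg = ICVaR.icvarL (d := d) ⟨M.r, φ, α, ε, lam, β⟩ T),
      ENNReal.ofReal (1 - 2 * δ) ≤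
        (ICVaR.runLaw M env alg K).toOuterMeasure
          {hist | ICVaR.regret α M alg hist ≤ ICVaR.regretBound d H K α δ β}) ∧
    -- the order of the bound, up to a universal constant and a logarithmic factor
    (∃ C : ℝ, 0 < C ∧ ∀ (d H K : ℕ) (α δ : ℝ), 1 ≤ d → 1 ≤ H → 1 ≤ K →
      α ∈ Set.Ioc (0 : ℝ) 1 → δ ∈ Set.Ioc (0 : ℝ) 1 →
      ICVaR.regretBound d H K α δ (ICVaR.betaHat d H K δ ((H : ℝ) ^ 2)) ≤
        C * (1 + Real.log (K * H / δ)) *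
          √(((d : ℝ) ^ 2 * (H : ℝ) ^ 4 + d * (H : ℝ) ^ 6) * K / α ^ (H + 1))) := by
  refine ⟨?_, 28, by norm_num, fun d H K α δ hd hH hK hα hδ =>
    ICVaR.regretBound_le hd hH hK hα hδ⟩
  intro S A _ _ d H K hH hK α δ lam ε β hα hδ hlam hε hβ M φ hφ hM env T alg halg
  -- For `δ ≥ 1/2` the claimed probability is at most `0`.
  rcases le_or_gt (1 / 2) δ with hδ2 | hδ2
  · rw [ENNReal.ofReal_of_nonpos (by linarith)]
    exact zero_le
  -- The first initial state shows that `S` is nonempty, which is needed to exclude `d = 0`.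
  obtain ⟨s, -⟩ := (env []).support_nonempty
  have hd : 0 < d := hM.dim_pos hH s
  have hα0 := hα.1
  have hI : (⟨M.r, φ, α, ε, lam, β⟩ : ICVaR.Input S A H d).Valid :=
    { horizon_pos := hH
      α_mem := hα
      ε_pos := by
        change 0 < ε
        rw [hε]
        positivity
      β_nonneg := by
        change 0 ≤ β
        rw [hβ, ICVaR.betaHat]
        positivity
      r_nonneg := fun h s a => (M.r_mem h s a).1
      lam_eq := hlam
      normalized := hφ }
  subst halg
  exact ICVaR.le_toOuterMeasure_regret_le hI T M env rfl hM hd hK hδ.1 hδ2 hε (hlam ▸ hβ)
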